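/- All forms are integral binary quadratic forms $(a,b,c)=ax^2+bxy+cy^2$ that are primitive and positive definite ($a>0$ and discriminant $b^2-4ac<0$). Classes are taken under the action of $SL(2,\mathbb Z)$. The assigned characters of a discriminant $\Delta<0$ are the following functions of an integer $r$ coprime to $\Delta$: the Legendre symbol $\left(\frac rq\right)$ for each odd prime $q\mid\Delta$; $\left(\frac{-1}r\right)$ if $\Delta\equiv 12\pmod{16}$ or $\Delta\equiv 0\pmod{16}$; $\left(\frac{2}r\right)$ if $\Delta\equiv 8\pmod{32}$ or $\Delta\equiv 0\pmod{32}$; $\left(\frac{-2}r\right)$ if $\Delta\equiv 24\pmod{32}$. Each assigned character of $\Delta$ takes the same value at all integers coprime to $\Delta$ that a given form of discriminant $\Delta$ represents, and two forms of discriminant $\Delta$ are in the same genus if these values agree for all assigned characters of $\Delta$. A form is alone in its genus if its class is the only class in its genus. For a prime $p$, a genus $g$ of discriminant $\Delta$ and a genus $G$ of discriminant $\Delta p^2$, write $\Phi_p(G)=g$ if $\chi(r_1)=\chi(r_2)$ for every assigned character $\chi$ of $\Delta$, where $r_1,r_2$ are integers coprime to $\Delta p^2$ and represented by $g$ and $G$,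 respectively. Put $\theta_{(a,b,c)}(q)=\sum_{x,y\in\mathbb Z}q^{ax^2+bxy+cy^2}$ (a formal power series) and $P_{m,r}\sum_{n\ge 0}a(n)q^n=\sum_{n\ge 0,\ n\equiv r\ (\mathrm{mod}\ m)}a(n)q^n$. **Theorem.** Let $p$ be a prime. Let $(a,b,c)$ have discriminant $\Delta$ and be alone in its genus $g$, let $(A,B,C)$ have discriminant $\Delta p^2$ and be alone in its genus $G$, and suppose that $\Phi_p(G)=g$. Let $r$ be any integer coprime to $\Delta p^2$ that is represented by $(A,B,C)$. Put $w=3$ if $\Delta=-3$, $w=2$ if $\Delta=-4$, and $w=1$ if $\Delta<-4$. Put $t=2$ if $\Delta\equiv 0\pmod{16}$, and otherwise $t=0$ if $\Delta$ is odd and $t=1$ if $\Delta$ is even. If $p$ is odd, then $$w\,\theta_{(A,B,C)}(q)=w\,\theta_{(a,b,c)}(q^{p^2})+\sum_{i=1}^{p-1}\frac{\left(\frac{ri}{p}\right)+1}{2}\,P_{p,i}\,\theta_{(a,b,c)}(q).$$ If $p=2$, then $$w\,\theta_{(A,B,C)}(q)=w\,\theta_{(a,b,c)}(q^{4})+P_{2^{t+1},r}\,\theta_{(a,b,c)}(q).$$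 -/

import Mathlib

/-- An integral binary quadratic form `a x² + b x y + c y²`. -/
@[ext]
structure BinForm where
  a : ℤ
  b : ℤ
  c : ℤ

namespace BinForm

/-- The value of the form at `(x, y)`. -/
def eval (f : BinForm) (x y : ℤ) : ℤ := f.a * x ^ 2 + f.b * x * y + f.c * y ^ 2

/-- The discriminant `b² - 4ac`. -/
def disc (f : BinForm) : ℤ := f.b ^ 2 - 4 * f.a * f.c

/-- Every common divisor of the three coefficients is a unit. -/
def IsPrimitive (f : BinForm) : Prop :=
  ∀ d : ℤ, d ∣ f.a → d ∣ f.b → d ∣ f.c → IsUnit d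

/-- The forms whose classes make up the class group `CL(Δ)`: primitive and positive definite
(`Δ < 0` and `a > 0`), of discriminant `Δ`. -/
structure OfDisc (Δ : ℤ) (f : BinForm) : Prop where
  disc_eq : f.disc = Δ
  disc_neg : Δ < 0
  a_pos : 0 < f.a
  primitive : f.IsPrimitive

/-- Proper equivalence: a substitution in `SL(2, ℤ)` carries `f` to `g`. -/
def Equivalent (f g : BinForm) : Prop :=
  ∃ M : Matrix.SpecialLinearGroup (Fin 2) ℤ, ∀ x y : ℤ,
    g.eval x y = f.eval (M.1 0 0 * x + M.1 0 1 * y) (M.1 1 0 * x + M.1 1 1 * y)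

/-- `f` represents the integer `n`. -/
def Represents (f : BinForm) (n : ℤ) : Prop := ∃ x y : ℤ, f.eval x y = n

/-- The theta series `∑_{x,y} q^{f(x,y)}`: its `n`-th coefficient is the total number of
representations of `n` by `f`, which is finite when `f` is positive definite. -/
noncomputable def theta (f : BinForm) : PowerSeries ℚ :=
  PowerSeries.mk fun n => (Nat.card {v : ℤ × ℤ // f.eval v.1 v.2 = (n : ℤ)} : ℚ)

end BinForm

/-- The assigned characters of a discriminant `Δ`, as functions of an integer `r` coprime to `Δ`:
the Legendre symbols `(r/q)` for the odd primes `q ∣ Δ`, together with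
`(-1/r)` if `Δ/4 ≡ 3 (mod 4)` or `Δ/4 ≡ 0 (mod 4)`, `(2/r)` if `Δ/4 ≡ 2 (mod 8)` or
`Δ/4 ≡ 0 (mod 8)`, and `(-2/r)` if `Δ/4 ≡ 6 (mod 8)`.
(If `Δ/4 ≡ 0 (mod 8)`, then `(-2/r)` is the product of the other two.) -/
inductive IsAssignedCharacter (Δ : ℤ) : (ℤ → ℤ) → Prop
  | odd_prime (q : ℕ) [Fact q.Prime] (hq : q ≠ 2) (hd : (q : ℤ) ∣ Δ) :
      IsAssignedCharacter Δ (fun r => legendreSym q r)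
  | neg_one (h : Δ % 16 = 12 ∨ Δ % 16 = 0) :
      IsAssignedCharacter Δ (fun r => ZMod.χ₄ (r : ZMod 4))
  | two (h : Δ % 32 = 8 ∨ Δ % 32 = 0) :
      IsAssignedCharacter Δ (fun r => ZMod.χ₈ (r : ZMod 8))
  | neg_two (h : Δ % 32 = 24) :
      IsAssignedCharacter Δ (fun r => ZMod.χ₈' (r : ZMod 8))

/-- The genus of `f` among the forms of discriminant `Δ`: the forms of discriminant `Δ` with the
same assigned character values as `f`. The values of a form are read off at an integer that it
represents and that is coprime to `Δ`; they do not depend on the choice of that integer. -/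
def genus (Δ : ℤ) (f : BinForm) : Set BinForm :=
  {h | h.OfDisc Δ ∧ ∃ r s : ℤ, IsCoprime r Δ ∧ IsCoprime s Δ ∧ f.Represents r ∧ h.Represents s ∧
    ∀ χ, IsAssignedCharacter Δ χ → χ r = χ s}

/-- The class of `f` is the only class in its genus. -/
def AloneInGenus (Δ : ℤ) (f : BinForm) : Prop :=
  ∀ h ∈ genus Δ f, f.Equivalent h

/-- An integer is represented by a genus if some form of the genus represents it. -/
def GenusRepresents (G : Set BinForm) (n : ℤ) : Prop := ∃ h ∈ G, h.Represents n

/-- `Φ_p(G) = g`, for a genus `g` of discriminant `Δ` and a genus `G` of discriminant `Δ p²`: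
integers `r₁`, `r₂` coprime to `Δ p²` and represented by `g` and `G`, respectively, have the same
values under all assigned characters of `Δ`. -/
def Corresponds (Δ : ℤ) (p : ℕ) (G g : Set BinForm) : Prop :=
  ∃ r₁ r₂ : ℤ, IsCoprime r₁ (Δ * (p : ℤ) ^ 2) ∧ IsCoprime r₂ (Δ * (p : ℤ) ^ 2) ∧
    GenusRepresents g r₁ ∧ GenusRepresents G r₂ ∧
    ∀ χ, IsAssignedCharacter Δ χ → χ r₁ = χ r₂

/-- The operator `P_{m,r}`: keep the terms whose exponent is congruent to `r` modulo `m`. -/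
noncomputable def proj (m : ℕ) (r : ℤ) (φ : PowerSeries ℚ) : PowerSeries ℚ :=
  open Classical in
  PowerSeries.mk fun n => if (n : ℤ) ≡ r [ZMOD (m : ℤ)] then PowerSeries.coeff n φ else 0

/-- The substitution `q ↦ q ^ m` in a power series in `q` (for `m ≥ 1`). -/
noncomputable def qpow (m : ℕ) (φ : PowerSeries ℚ) : PowerSeries ℚ :=
  PowerSeries.mk fun n => if m ∣ n then PowerSeries.coeff (n / m) φ else 0

/-- The number `w`: `3` for `Δ = -3`, `2` for `Δ = -4`, and `1` for `Δ < -4`. -/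
def wNum (Δ : ℤ) : ℚ := if Δ = -3 then 3 else if Δ = -4 then 2 else 1

/-- The number `t`: `2` for `Δ ≡ 0 (mod 16)`, and otherwise `0` or `1` according to whether `Δ`
is odd or even. -/
def tNum (Δ : ℤ) : ℕ := if (16 : ℤ) ∣ Δ then 2 else if (2 : ℤ) ∣ Δ then 1 else 0

/-!
Let `X` be the set of integral matrices `M` of determinant `p` with `f ∘ M = F`, that is, the
embeddings of `F` into `f` with image of index `p`.

*Embeddings.* Since `F` is primitive, a translation brings it to the shape `(a, bp, cp²)`; the form
`(a, b, c)` has discriminant `Δ` and lies in the genus of `f`, because `Φ_p(G) = g`. As `f` is alone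
in its genus, `X` is nonempty (`exists_subst_eq`). Two elements of `X` differ by an integral
automorph of `f` (`exists_automorph_of_subst_eq`), so `X` is a torsor under a group of order `2w`.

*Multiples of `p`.* If `p ∣ F(x)`, then `M x ∈ p ℤ²` for `M ∈ X`, whence `F` represents `n`
exactly as often as `f` represents `n / p²` when `p ∣ n` (`card_eval_eq_sq_mul`).

*Exponents prime to `p`.* If `p ∤ n` and `F` represents `n`, then `n` has the residue of `r` at `p`:
the same Legendre symbol, or the same class modulo `2 ^ (t + 1)` (`Represents.sameResidue`).
Conversely, let `f(v) = n` for such an `n`. The restriction of `f` to the lattice `ℤ v + p ℤ²` is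
primitive of discriminant `Δ p²`, and it lies in the genus of `F`, because the assigned characters
of `Δ p²` are determined by those of `Δ` and the residue at `p` (`assignedCharacter_mul_sq_eq`).
As `F` is alone in its genus, `v = M x` for some `M ∈ X` (`exists_subst_eq_of_eval`), and `x` is
unique up to sign since `F`, of discriminant less than `-4`, has only the automorphs `± 1`
(`eq_or_eq_neg_of_act_eq`). Counting the pairs `(x, v)` with `v ∈ X x` in two ways shows that `w`
times the number of representations of `n` by `F` is the number of those by `f`
(`wNum_mul_card_eval_eq`).
-/

namespace BinForm

open Matrix

/-! ### Linear substitutions -/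

/-- The form `f ∘ M`, for an integral matrix `M` of any determinant. -/
def subst (f : BinForm) (M : Matrix (Fin 2) (Fin 2) ℤ) : BinForm where
  a := f.eval (M 0 0) (M 1 0)
  b := 2 * f.a * M 0 0 * M 0 1 + f.b * (M 0 0 * M 1 1 + M 0 1 * M 1 0) + 2 * f.c * M 1 0 * M 1 1
  c := f.eval (M 0 1) (M 1 1)

theorem eval_subst (f : BinForm) (M : Matrix (Fin 2) (Fin 2) ℤ) (x y : ℤ) :
    (f.subst M).eval x y = f.eval (M 0 0 * x + M 0 1 * y) (M 1 0 * x + M 1 1 * y) := by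
  simp only [eval, subst]; ring

theorem eq_of_eval_eq {f g : BinForm} (h : ∀ x y, f.eval x y = g.eval x y) : f = g := by
  have h1 := h 1 0
  have h2 := h 0 1
  have h3 := h 1 1
  simp only [eval] at h1 h2 h3
  ext <;> linarith

theorem subst_mul (f : BinForm) (M N : Matrix (Fin 2) (Fin 2) ℤ) :
    f.subst (M * N) = (f.subst M).subst N := by
  apply eq_of_eval_eq
  intro x y
  simp only [eval_subst, Matrix.mul_apply, Fin.sum_univ_two]
  congr 1 <;> ring

theorem subst_smul_one (f : BinForm) (k : ℤ) :
    f.subst (k • (1 : Matrix (Fin 2) (Fin 2) ℤ)) = ⟨k ^ 2 * f.a, k ^ 2 * f.b, k ^ 2 * f.c⟩ := by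
  ext <;> simp [subst, eval] <;> ring

theorem subst_one (f : BinForm) : f.subst 1 = f := by
  ext <;> simp [subst, eval]

theorem disc_subst (f : BinForm) (M : Matrix (Fin 2) (Fin 2) ℤ) :
    (f.subst M).disc = M.det ^ 2 * f.disc := by
  simp only [disc, subst, eval, Matrix.det_fin_two]; ring

theorem equivalent_iff {f g : BinForm} :
    f.Equivalent g ↔ ∃ M : Matrix (Fin 2) (Fin 2) ℤ, M.det = 1 ∧ g = f.subst M := by
  constructor
  · rintro ⟨M, hM⟩
    exact ⟨M.1, M.2, eq_of_eval_eq fun x y => by rw [hM, eval_subst]⟩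
  · rintro ⟨M, hM, rfl⟩
    exact ⟨⟨M, hM⟩, fun x y => eval_subst f M x y⟩

theorem Equivalent.represents {f g : BinForm} (h : f.Equivalent g) {n : ℤ}
    (hn : g.Represents n) : f.Represents n := by
  obtain ⟨M, hM⟩ := h
  obtain ⟨x, y, hxy⟩ := hn
  exact ⟨_, _, (hM x y).symm.trans hxy⟩

theorem Represents.of_subst {f : BinForm} {M : Matrix (Fin 2) (Fin 2) ℤ} {n : ℤ}
    (h : (f.subst M).Represents n) : f.Represents n := by
  obtain ⟨x, y, hxy⟩ := h
  exact ⟨_, _, (eval_subst f M x y).symm.trans hxy⟩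

theorem subst_adjugate_of_subst_eq {f F : BinForm} {M : Matrix (Fin 2) (Fin 2) ℤ}
    (h : f.subst M = F) :
    F.subst M.adjugate = ⟨M.det ^ 2 * f.a, M.det ^ 2 * f.b, M.det ^ 2 * f.c⟩ := by
  rw [← h, ← subst_mul, Matrix.mul_adjugate, subst_smul_one]

theorem subst_scale (f : BinForm) (k : ℤ) (M : Matrix (Fin 2) (Fin 2) ℤ) :
    (⟨k * f.a, k * f.b, k * f.c⟩ : BinForm).subst M =
      ⟨k * (f.subst M).a, k * (f.subst M).b, k * (f.subst M).c⟩ := by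
  ext <;> simp [subst, eval] <;> ring

/-- The action of an integral matrix on column vectors, written as pairs. -/
def act (M : Matrix (Fin 2) (Fin 2) ℤ) (v : ℤ × ℤ) : ℤ × ℤ :=
  (M 0 0 * v.1 + M 0 1 * v.2, M 1 0 * v.1 + M 1 1 * v.2)

theorem eval_act (f : BinForm) (M : Matrix (Fin 2) (Fin 2) ℤ) (v : ℤ × ℤ) :
    f.eval (act M v).1 (act M v).2 = (f.subst M).eval v.1 v.2 :=
  (eval_subst f M v.1 v.2).symm

theorem act_mul (M N : Matrix (Fin 2) (Fin 2) ℤ) (v : ℤ × ℤ) :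
    act (M * N) v = act M (act N v) := by
  simp only [act, Matrix.mul_apply, Fin.sum_univ_two]
  ext <;> ring

theorem act_adjugate_act (M : Matrix (Fin 2) (Fin 2) ℤ) (v : ℤ × ℤ) :
    act M.adjugate (act M v) = (M.det * v.1, M.det * v.2) := by
  rw [← act_mul, Matrix.adjugate_mul]
  simp [act]

theorem act_injective {M : Matrix (Fin 2) (Fin 2) ℤ} (h : M.det ≠ 0) :
    Function.Injective (act M) := by
  intro v w hvw
  have := congrArg (act M.adjugate) hvw
  simp only [act_adjugate_act, Prod.mk.injEq] at this
  exact Prod.ext (mul_left_cancel₀ h this.1) (mul_left_cancel₀ h this.2)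

/-! ### Primitivity and positivity -/

theorem IsPrimitive.exists_bezout {f : BinForm} (h : f.IsPrimitive) :
    ∃ k l m : ℤ, k * f.a + l * f.b + m * f.c = 1 := by
  have hu : IsUnit (gcd f.a (gcd f.b f.c)) :=
    h _ (gcd_dvd_left _ _) ((gcd_dvd_right _ _).trans (gcd_dvd_left _ _))
      ((gcd_dvd_right _ _).trans (gcd_dvd_right _ _))
  obtain ⟨x, y, h1⟩ := exists_gcd_eq_mul_add_mul f.a (gcd f.b f.c)
  obtain ⟨z, w, h2⟩ := exists_gcd_eq_mul_add_mul f.b f.c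
  obtain ⟨v, hv⟩ := hu.exists_left_inv
  refine ⟨v * x, v * y * z, v * y * w, ?_⟩
  rw [h1, h2] at hv
  linear_combination hv

theorem isPrimitive_of_subst {f : BinForm} {M : Matrix (Fin 2) (Fin 2) ℤ}
    (h : (f.subst M).IsPrimitive) : f.IsPrimitive := by
  intro d ha hb hc
  obtain ⟨a, ha⟩ := ha
  obtain ⟨b, hb⟩ := hb
  obtain ⟨c, hc⟩ := hc
  have hf : f = ⟨d * a, d * b, d * c⟩ := BinForm.ext ha hb hc
  rw [hf, subst_scale ⟨a, b, c⟩ d M] at h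
  exact h d (dvd_mul_right _ _) (dvd_mul_right _ _) (dvd_mul_right _ _)

theorem IsPrimitive.subst {f : BinForm} {M : Matrix (Fin 2) (Fin 2) ℤ} (h : f.IsPrimitive)
    (hM : M.det = 1) : (f.subst M).IsPrimitive := by
  apply isPrimitive_of_subst (M := M.adjugate)
  rwa [← subst_mul, Matrix.mul_adjugate, hM, one_smul, subst_one]

theorem four_mul_a_mul_eval (f : BinForm) (x y : ℤ) :
    4 * f.a * f.eval x y = (2 * f.a * x + f.b * y) ^ 2 - f.disc * y ^ 2 := by
  simp only [eval, disc]; ring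

theorem OfDisc.eval_pos {Δ : ℤ} {f : BinForm} (h : f.OfDisc Δ) {x y : ℤ}
    (hxy : ¬(x = 0 ∧ y = 0)) : 0 < f.eval x y := by
  have h1 := four_mul_a_mul_eval f x y
  have ha := h.a_pos
  have hd := h.disc_neg
  rw [h.disc_eq] at h1
  have h2 : 0 < 4 * f.a * f.eval x y := by
    rw [h1]
    by_cases hy : y = 0
    · have hx : x ≠ 0 := fun hx => hxy ⟨hx, hy⟩
      subst hy
      have : 0 < (2 * f.a * x) ^ 2 := by positivity
      simpa using this
    · have : 0 < y ^ 2 := by positivity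
      nlinarith [sq_nonneg (2 * f.a * x + f.b * y)]
  exact pos_of_mul_pos_right h2 (by linarith)

theorem OfDisc.finite_eval_eq {Δ : ℤ} {f : BinForm} (h : f.OfDisc Δ) (n : ℤ) :
    {v : ℤ × ℤ | f.eval v.1 v.2 = n}.Finite := by
  have ha := h.a_pos
  have hd := h.disc_neg
  set B := 4 * f.a * n
  have key : ∀ v : ℤ × ℤ, f.eval v.1 v.2 = n →
      (2 * f.a * v.1 + f.b * v.2, v.2) ∈ Set.Icc (-B) B ×ˢ Set.Icc (-B) B := by
    rintro ⟨x, y⟩ hv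
    have h1 := four_mul_a_mul_eval f x y
    rw [h.disc_eq] at h1
    dsimp only at hv
    rw [hv] at h1
    change B = _ at h1
    have hs : ∀ z : ℤ, z ^ 2 ≤ B → z ∈ Set.Icc (-B) B := fun z hz => by
      have := Int.le_self_sq z
      have := Int.le_self_sq (-z)
      constructor <;> nlinarith
    refine ⟨hs _ ?_, hs _ ?_⟩ <;> dsimp only
    · nlinarith [sq_nonneg y]
    · nlinarith [sq_nonneg y, sq_nonneg (2 * f.a * x + f.b * y)]
  refine Set.Finite.of_finite_image (f := fun v : ℤ × ℤ => (2 * f.a * v.1 + f.b * v.2, v.2))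
    (((Set.finite_Icc (-B) B).prod (Set.finite_Icc (-B) B)).subset ?_) ?_
  · rintro _ ⟨v, hv, rfl⟩
    exact key v hv
  · rintro ⟨x, y⟩ _ ⟨x', y'⟩ _ hxy
    simp only [Prod.mk.injEq] at hxy ⊢
    obtain ⟨h1, rfl⟩ := hxy
    have : 2 * f.a * (x - x') = 0 := by linear_combination h1
    rcases mul_eq_zero.1 this with h2 | h2
    · omega
    · omega

/-- A primitive form represents an integer coprime to any given `m ≠ 0`: modulo a prime `q ∣ m`
one of the values at `(1, 0)`, `(0, 1)`, `(1, 1)` is nonzero, and products of the primes of each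
of the three kinds replace the Chinese remainder theorem. -/
theorem IsPrimitive.exists_represents_isCoprime {f : BinForm} (h : f.IsPrimitive) {m : ℤ}
    (hm : m ≠ 0) : ∃ s, f.Represents s ∧ IsCoprime s m := by
  classical
  set S := m.natAbs.primeFactors
  set x : ℤ := ∏ q ∈ S.filter (fun q : ℕ => (q : ℤ) ∣ f.a ∧ ¬ (q : ℤ) ∣ f.c), (q : ℤ) with hx
  set y : ℤ := ∏ q ∈ S.filter (fun q : ℕ => ¬ (q : ℤ) ∣ f.a), (q : ℤ) with hy
  have hdvd : ∀ q : ℕ, q.Prime → q ∈ S → ∀ (P : ℕ → Prop) [DecidablePred P],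
      (q : ℤ) ∣ ∏ l ∈ S with P l, (l : ℤ) ↔ P q := by
    intro q hq hqS P _
    constructor
    · intro hd
      obtain ⟨l, hl, hql⟩ := (Prime.dvd_finsetProd_iff (Nat.prime_iff_prime_int.1 hq) _).1 hd
      rw [Finset.mem_filter] at hl
      have := (Nat.prime_dvd_prime_iff_eq hq (Nat.prime_of_mem_primeFactors hl.1)).1
        (Int.natCast_dvd_natCast.1 hql)
      exact this ▸ hl.2
    · intro hP
      exact Finset.dvd_prod_of_mem (fun l : ℕ => (l : ℤ)) (Finset.mem_filter.2 ⟨hqS, hP⟩)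
  refine ⟨f.eval x y, ⟨x, y, rfl⟩, ?_⟩
  rw [Int.isCoprime_iff_gcd_eq_one, Int.gcd]
  refine Nat.Coprime.gcd_eq_one (Nat.coprime_of_dvd fun q hq h1 h2 => ?_)
  have hqS : q ∈ S := Nat.mem_primeFactors.2 ⟨hq, h2, by simpa using hm⟩
  have hqp : Prime (q : ℤ) := Nat.prime_iff_prime_int.1 hq
  have hqx := hdvd q hq hqS fun q => (q : ℤ) ∣ f.a ∧ ¬ (q : ℤ) ∣ f.c
  have hqy := hdvd q hq hqS fun q => ¬ (q : ℤ) ∣ f.a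
  rw [← hx] at hqx
  rw [← hy] at hqy
  have h3 : (q : ℤ) ∣ f.a * x ^ 2 + f.b * x * y + f.c * y ^ 2 := Int.natCast_dvd.2 h1
  by_cases ha : (q : ℤ) ∣ f.a
  · have hy' : ¬ (q : ℤ) ∣ y := fun h' => hqy.1 h' ha
    by_cases hc : (q : ℤ) ∣ f.c
    · have hx' : ¬ (q : ℤ) ∣ x := fun h' => (hqx.1 h').2 hc
      have h4 : (q : ℤ) ∣ f.b * x * y := by
        obtain ⟨z, hz⟩ := (h3.sub (ha.mul_right (x ^ 2))).sub (hc.mul_right (y ^ 2))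
        exact ⟨z, by linear_combination hz⟩
      rcases hqp.dvd_or_dvd h4 with h5 | h5
      · rcases hqp.dvd_or_dvd h5 with h6 | h6
        · exact hqp.not_isUnit (h _ ha h6 hc)
        · exact hx' h6
      · exact hy' h5
    · have hx' := hqx.2 ⟨ha, hc⟩
      have h4 : (q : ℤ) ∣ f.c * y ^ 2 := by
        obtain ⟨z, hz⟩ := h3.sub (hx'.mul_right (f.a * x + f.b * y))
        exact ⟨z, by linear_combination hz⟩
      rcases hqp.dvd_or_dvd h4 with h5 | h5
      · exact hc h5
      · exact hy' (hqp.dvd_of_dvd_pow h5)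
  · have hy' := hqy.2 ha
    have hx' : ¬ (q : ℤ) ∣ x := fun h' => ha (hqx.1 h').1
    have h4 : (q : ℤ) ∣ f.a * x ^ 2 := by
      obtain ⟨z, hz⟩ := h3.sub (hy'.mul_right (f.b * x + f.c * y))
      exact ⟨z, by linear_combination hz⟩
    rcases hqp.dvd_or_dvd h4 with h5 | h5
    · exact ha h5
    · exact hx' (hqp.dvd_of_dvd_pow h5)

/-- A nonzero vector is a multiple of the first column of a matrix of determinant `1`. -/
theorem exists_det_eq_one_smul_col {x y : ℤ} (h : ¬(x = 0 ∧ y = 0)) :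
    ∃ (M : Matrix (Fin 2) (Fin 2) ℤ) (d : ℤ), M.det = 1 ∧ x = M 0 0 * d ∧ y = M 1 0 * d := by
  obtain ⟨k, l, hkl⟩ := exists_gcd_eq_mul_add_mul x y
  obtain ⟨x', hx⟩ := gcd_dvd_left x y
  obtain ⟨y', hy⟩ := gcd_dvd_right x y
  have hd : gcd x y ≠ 0 := fun h0 => h ((gcd_eq_zero_iff x y).1 h0)
  refine ⟨!![x', -l; y', k], gcd x y, ?_, ?_, ?_⟩
  · rw [Matrix.det_fin_two_of]
    apply mul_left_cancel₀ hd
    linear_combination (-1 : ℤ) * hkl - k * hx - l * hy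
  · simpa [mul_comm] using hx
  · simpa [mul_comm] using hy

/-! ### Automorphs -/

/-- A similitude `K` of a primitive form that multiplies it by `det K` lies in the quadratic order
of discriminant `b² - 4ac`. Indeed `Kᵀ S K = det K • S` for the Gram matrix `S` amounts to
`Kᵀ S = S adj K`, which is linear in `K`. -/
theorem exists_of_subst_eq_det {f : BinForm} (hf : f.IsPrimitive) {K : Matrix (Fin 2) (Fin 2) ℤ}
    (hK : K.det ≠ 0) (h : f.subst K = ⟨K.det * f.a, K.det * f.b, K.det * f.c⟩) :
    ∃ u : ℤ, K 1 0 = f.a * u ∧ K 0 1 = -(f.c * u) ∧ K 1 1 = K 0 0 + f.b * u := by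
  obtain ⟨k, l, m, hb⟩ := hf.exists_bezout
  have e1 := congrArg BinForm.a h
  have e2 := congrArg BinForm.b h
  have e3 := congrArg BinForm.c h
  simp only [subst, eval] at e1 e2 e3
  have hd := Matrix.det_fin_two K
  set d := K.det
  set α := K 0 0
  set β := K 0 1
  set γ := K 1 0
  set δ := K 1 1
  have h1 : f.a * (δ - α) = f.b * γ := by
    apply mul_left_cancel₀ (mul_ne_zero two_ne_zero hK)
    linear_combination (-2 * δ) * e1 + γ * e2 - (2 * f.a * α + f.b * γ) * hd
  have h2 : f.c * γ = -(f.a * β) := by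
    apply mul_left_cancel₀ (mul_ne_zero two_ne_zero hK)
    linear_combination (-2 * β) * e1 + α * e2 + (f.b * α + 2 * f.c * γ) * hd
  have h3 : f.c * (δ - α) = -(f.b * β) := by
    apply mul_left_cancel₀ (mul_ne_zero two_ne_zero hK)
    linear_combination (-β) * e2 + (2 * α) * e3 + (f.b * β + 2 * f.c * δ) * hd
  refine ⟨k * γ + l * (δ - α) - m * β, ?_, ?_, ?_⟩
  · linear_combination (-γ) * hb - l * h1 + m * h2
  · linear_combination (-β) * hb + k * h2 + l * h3
  · linear_combination (α - δ) * hb + k * h1 + m * h3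

theorem trace_sq_sub_disc {f : BinForm} {K : Matrix (Fin 2) (Fin 2) ℤ} {u : ℤ}
    (h1 : K 1 0 = f.a * u) (h2 : K 0 1 = -(f.c * u)) (h3 : K 1 1 = K 0 0 + f.b * u) :
    K.trace ^ 2 - f.disc * u ^ 2 = 4 * K.det := by
  rw [Matrix.det_fin_two, Matrix.trace_fin_two, h1, h2, h3, disc]; ring

theorem exists_eq_smul_of_dvd {K : Matrix (Fin 2) (Fin 2) ℤ} {k : ℤ} (h : ∀ i j, k ∣ K i j) :
    ∃ N : Matrix (Fin 2) (Fin 2) ℤ, K = k • N := by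
  choose N hN using h
  exact ⟨Matrix.of N, by ext i j; simp [hN i j]⟩

theorem subst_mul_adjugate {f F : BinForm} {k : ℤ} {M M' : Matrix (Fin 2) (Fin 2) ℤ}
    (hM : M.det = k) (hf : f.subst M = F) (hf' : f.subst M' = F) :
    f.subst (M' * M.adjugate) = ⟨k ^ 2 * f.a, k ^ 2 * f.b, k ^ 2 * f.c⟩ := by
  rw [subst_mul, hf', subst_adjugate_of_subst_eq hf, hM]

theorem subst_adjugate_mul {f F : BinForm} {k : ℤ} {M M' : Matrix (Fin 2) (Fin 2) ℤ}
    (hM : M.det = k) (hf : f.subst M = F) (hf' : f.subst M' = F) :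
    F.subst (M.adjugate * M') = ⟨k ^ 2 * F.a, k ^ 2 * F.b, k ^ 2 * F.c⟩ := by
  rw [subst_mul, subst_adjugate_of_subst_eq hf, hM, subst_scale, hf']

theorem det_mul_adjugate {k : ℤ} {M M' : Matrix (Fin 2) (Fin 2) ℤ}
    (hM : M.det = k) (hM' : M'.det = k) : (M' * M.adjugate).det = k ^ 2 := by
  rw [Matrix.det_mul, Matrix.det_adjugate, hM, hM']; simp [sq]

/-- The embeddings of index `k` of a primitive form of discriminant `Δ k²` into a primitive form
of discriminant `Δ` differ by integral automorphs. The matrix `k N = M' adj M` has the trace of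
`adj M * M'`, which is a similitude of `F`; comparing discriminants shows that `k` divides the
off-diagonal parameter of `k N`, and then all its entries. -/
theorem exists_automorph_of_subst_eq {f F : BinForm} (hfp : f.IsPrimitive) (hFp : F.IsPrimitive)
    (hΔ : f.disc ≠ 0) {k : ℤ} (hk : k ≠ 0) {M M' : Matrix (Fin 2) (Fin 2) ℤ}
    (hM : M.det = k) (hM' : M'.det = k) (hf : f.subst M = F) (hf' : f.subst M' = F) :
    ∃ N : Matrix (Fin 2) (Fin 2) ℤ, N.det = 1 ∧ f.subst N = f ∧ M' = N * M := by
  have hk2 : k ^ 2 ≠ 0 := pow_ne_zero _ hk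
  set K := M' * M.adjugate with hKdef
  have hKdet : K.det = k ^ 2 := det_mul_adjugate hM hM'
  have hKdet' : (M.adjugate * M').det = k ^ 2 := by
    rw [Matrix.det_mul, mul_comm, ← Matrix.det_mul, ← hKdef, hKdet]
  have hKs := subst_mul_adjugate hM hf hf'
  have hKs' := subst_adjugate_mul hM hf hf'
  rw [← hKdef] at hKs
  obtain ⟨u, h1, h2, h3⟩ := exists_of_subst_eq_det hfp (by rwa [hKdet]) (by rw [hKs, hKdet])
  obtain ⟨u', g1, g2, g3⟩ := exists_of_subst_eq_det hFp (by rwa [hKdet']) (by rw [hKs', hKdet'])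
  have ht := trace_sq_sub_disc h1 h2 h3
  have ht' := trace_sq_sub_disc g1 g2 g3
  rw [Matrix.trace_mul_comm, ← hKdef, hKdet', ← hf, disc_subst, hM] at ht'
  rw [hKdet] at ht
  have hu : u ^ 2 = (k * u') ^ 2 := by
    apply mul_left_cancel₀ hΔ
    linear_combination ht' - ht
  obtain ⟨v, hv⟩ : k ∣ u := by
    rw [← Int.pow_dvd_pow_iff two_ne_zero, hu]
    exact pow_dvd_pow_of_dvd (dvd_mul_right _ _) 2
  obtain ⟨t, htt⟩ : k ∣ K.trace := by
    rw [← Int.pow_dvd_pow_iff two_ne_zero]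
    exact ⟨4 + f.disc * v ^ 2, by rw [hv] at ht; linear_combination ht⟩
  have htv : t ^ 2 - f.disc * v ^ 2 = 4 := by
    apply mul_left_cancel₀ hk2
    rw [htt, hv] at ht
    linear_combination ht
  -- `t` and `f.b * v` have the same parity, because their squares agree modulo `4`
  obtain ⟨s, hs⟩ : (2 : ℤ) ∣ t - f.b * v := by
    have h4 : (2 : ℤ) ∣ t ^ 2 - (f.b * v) ^ 2 :=
      ⟨2 - 2 * f.a * f.c * v ^ 2, by rw [disc] at htv; linear_combination htv⟩
    rcases Int.even_or_odd t with h5 | h5 <;> rcases Int.even_or_odd (f.b * v) with h6 | h6 <;>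
      have h7 := even_iff_two_dvd.2 h4 <;> apply even_iff_two_dvd.1 <;>
      simp_all [parity_simps, ← Int.not_even_iff_odd]
  have h00 : K 0 0 = k * s := by
    rw [Matrix.trace_fin_two, h3, hv] at htt
    have : 2 * K 0 0 = 2 * (k * s) := by linear_combination htt + k * hs
    exact mul_left_cancel₀ two_ne_zero this
  obtain ⟨N, hN⟩ : ∃ N : Matrix (Fin 2) (Fin 2) ℤ, K = k • N := by
    apply exists_eq_smul_of_dvd
    have e00 : k ∣ K 0 0 := ⟨_, h00⟩
    have e10 : k ∣ K 1 0 := ⟨f.a * v, by rw [h1, hv]; ring⟩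
    have e01 : k ∣ K 0 1 := ⟨-(f.c * v), by rw [h2, hv]; ring⟩
    have e11 : k ∣ K 1 1 := ⟨s + f.b * v, by rw [h3, hv, h00]; ring⟩
    intro i j
    fin_cases i <;> fin_cases j <;> assumption
  refine ⟨N, ?_, ?_, ?_⟩
  · rw [hN, Matrix.det_smul, Fintype.card_fin] at hKdet
    exact mul_left_cancel₀ hk2 (by rw [hKdet, mul_one])
  · rw [hN] at hKs
    have e1 := congrArg BinForm.a hKs
    have e2 := congrArg BinForm.b hKs
    have e3 := congrArg BinForm.c hKs
    simp only [subst, eval, Matrix.smul_apply, smul_eq_mul] at e1 e2 e3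
    ext <;> apply mul_left_cancel₀ hk2 <;> simp only [subst, eval]
    · linear_combination e1
    · linear_combination e2
    · linear_combination e3
  · have h5 : k • M' = k • (N * M) := by
      rw [← Matrix.smul_mul, ← hN, hKdef, Matrix.mul_assoc, Matrix.adjugate_mul, hM,
        Matrix.mul_smul, Matrix.mul_one]
    exact smul_right_injective _ hk h5

/-- Two embeddings of index `p` of `F` into `f` that share a vector of norm prime to `p` have the
same image, and they differ by an automorph of `F`, which is `± 1` when the discriminant of `F`
is less than `-4`. -/
theorem eq_or_eq_neg_of_act_eq {f F : BinForm} (hFp : F.IsPrimitive) (hF4 : F.disc < -4)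
    {p : ℤ} (hp : Prime p) {M M' : Matrix (Fin 2) (Fin 2) ℤ}
    (hM : M.det = p) (hM' : M'.det = p) (hf : f.subst M = F) (hf' : f.subst M' = F)
    {v w : ℤ × ℤ} (hvw : act M v = act M' w) (hw : ¬ p ∣ F.eval w.1 w.2) :
    v = w ∨ v = -w := by
  have hp2 : p ^ 2 ≠ 0 := pow_ne_zero _ hp.ne_zero
  set K := M.adjugate * M' with hKdef
  have hKdet : K.det = p ^ 2 := by
    rw [hKdef, Matrix.det_mul, mul_comm, ← Matrix.det_mul, det_mul_adjugate hM hM']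
  have hKs : F.subst K = _ := subst_adjugate_mul hM hf hf'
  have hKw : act K w = (p * v.1, p * v.2) := by
    rw [hKdef, act_mul, ← hvw, act_adjugate_act, hM]
  obtain ⟨k0, k1⟩ := Prod.ext_iff.1 hKw
  dsimp only [act] at k0 k1
  obtain ⟨u, h1, h2, h3⟩ := exists_of_subst_eq_det hFp (by rwa [hKdet]) (by rw [hKs, hKdet])
  have ht := trace_sq_sub_disc h1 h2 h3
  rw [hKdet] at ht
  have hpu : p ∣ u := by
    have h4 : p ∣ u * F.eval (w.1) (w.2) := by
      refine ⟨v.2 * w.1 - v.1 * w.2, ?_⟩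
      rw [h2] at k0
      rw [h1, h3] at k1
      simp only [eval]
      linear_combination w.1 * k1 - w.2 * k0
    exact (hp.dvd_or_dvd h4).resolve_right hw
  obtain ⟨u', rfl⟩ := hpu
  obtain ⟨t, htt⟩ : p ∣ K.trace := by
    rw [← Int.pow_dvd_pow_iff two_ne_zero]
    exact ⟨4 + F.disc * u' ^ 2, by linear_combination ht⟩
  have htu : t ^ 2 - F.disc * u' ^ 2 = 4 := by
    apply mul_left_cancel₀ hp2
    rw [htt] at ht
    linear_combination ht
  have hu0 : u' = 0 := by
    by_contra h0
    have : 0 < u' ^ 2 := by positivity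
    nlinarith [sq_nonneg t]
  subst hu0
  simp only [mul_zero, neg_zero, add_zero] at h1 h2 h3
  have ht2 : (t - 2) * (t + 2) = 0 := by linear_combination htu
  rw [Matrix.trace_fin_two, h3] at htt
  rw [h2] at k0
  rw [h1, h3] at k1
  rcases mul_eq_zero.1 ht2 with h5 | h5
  · have h6 : K 0 0 = p := by
      apply mul_left_cancel₀ (two_ne_zero (α := ℤ)); linear_combination htt + p * h5
    left
    apply Prod.ext <;> apply mul_left_cancel₀ hp.ne_zero
    · linear_combination w.1 * h6 - k0
    · linear_combination w.2 * h6 - k1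
  · have h6 : K 0 0 = -p := by
      apply mul_left_cancel₀ (two_ne_zero (α := ℤ)); linear_combination htt + p * h5
    right
    apply Prod.ext <;> apply mul_left_cancel₀ hp.ne_zero <;>
      simp only [Prod.fst_neg, Prod.snd_neg]
    · linear_combination w.1 * h6 - k0
    · linear_combination w.2 * h6 - k1

theorem OfDisc.disc_emod_four {Δ : ℤ} {f : BinForm} (h : f.OfDisc Δ) :
    Δ % 4 = 0 ∨ Δ % 4 = 1 := by
  have h1 := h.disc_eq
  rw [disc, mul_assoc] at h1
  rcases Int.even_or_odd' f.b with ⟨k, hk | hk⟩ <;> rw [hk] at h1 <;> ring_nf at h1 <;> omega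

/-- The integral automorphs of a form are the matrices `(α, -cu; au, α + bu)` with
`α² + bαu + acu² = 1`; there are `2w` of them. -/
theorem OfDisc.exists_automorph_params {Δ : ℤ} {f : BinForm} (h : f.OfDisc Δ) :
    ∃ A : Finset (ℤ × ℤ),
      (∀ z : ℤ × ℤ, z ∈ A ↔ z.1 ^ 2 + f.b * z.1 * z.2 + f.a * f.c * z.2 ^ 2 = 1) ∧
      (A.card : ℚ) = 2 * wNum Δ := by
  have hneg := h.disc_neg
  have hmod := h.disc_emod_four
  have hdisc := h.disc_eq
  rw [disc] at hdisc
  have key : ∀ α u : ℤ, α ^ 2 + f.b * α * u + f.a * f.c * u ^ 2 = 1 ↔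
      (2 * α + f.b * u) ^ 2 - Δ * u ^ 2 = 4 := fun α u => by
    rw [← hdisc]
    constructor <;> intro h1
    · linear_combination 4 * h1
    · apply mul_left_cancel₀ (four_ne_zero (α := ℤ))
      linear_combination h1
  have hsmall : ∀ α u : ℤ, (2 * α + f.b * u) ^ 2 - Δ * u ^ 2 = 4 → u = 0 ∨
      (-4 ≤ Δ ∧ (u = 1 ∨ u = -1)) := fun α u h1 => by
    by_cases hu : u = 0
    · exact Or.inl hu
    · have h2 : 1 ≤ u ^ 2 := by have : 0 < u ^ 2 := by positivity
                                omega
      have h3 : u ^ 2 < 4 := by nlinarith [sq_nonneg (2 * α + f.b * u), show Δ ≤ -3 by omega]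
      have h4 : u < 2 := by nlinarith
      have h5 : -2 < u := by nlinarith
      refine Or.inr ⟨by nlinarith [sq_nonneg (2 * α + f.b * u)], by omega⟩
  have hsq : ∀ t m : ℤ, t ^ 2 = m ^ 2 ↔ t = m ∨ t = -m := fun t m => sq_eq_sq_iff_eq_or_eq_neg
  have hzero : ∀ α : ℤ, (2 * α + f.b * 0) ^ 2 - Δ * 0 ^ 2 = 4 ↔ α = 1 ∨ α = -1 := fun α => by
    have := hsq (2 * α) 2
    constructor <;> intro h1
    · rcases this.1 (by linear_combination h1) with h2 | h2 <;> omega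
    · rcases h1 with rfl | rfl <;> norm_num
  by_cases h3 : Δ = -3
  · obtain ⟨k, hk | hk⟩ := Int.even_or_odd' f.b
    · rw [hk] at hdisc; ring_nf at hdisc; omega
    refine ⟨{(1, 0), (-1, 0), (-k, 1), (-k - 1, 1), (k, -1), (k + 1, -1)}, ?_, ?_⟩
    · rintro ⟨α, u⟩
      rw [key, iff_comm]
      simp only [Finset.mem_insert, Finset.mem_singleton, Prod.mk.injEq]
      constructor
      · intro h1
        have h0 := hsmall α u h1
        rcases h0 with rfl | ⟨-, rfl | rfl⟩
        · have := (hzero α).1 h1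
          omega
        · rw [hk, h3] at h1
          have := (hsq (2 * α + (2 * k + 1)) 1).1 (by linear_combination h1)
          omega
        · rw [hk, h3] at h1
          have := (hsq (2 * α - (2 * k + 1)) 1).1 (by linear_combination h1)
          omega
      · rw [hk, h3]
        rintro (⟨rfl, rfl⟩ | ⟨rfl, rfl⟩ | ⟨rfl, rfl⟩ | ⟨rfl, rfl⟩ | ⟨rfl, rfl⟩ | ⟨rfl, rfl⟩) <;> ring
    · rw [wNum, if_pos h3, Finset.card_insert_of_notMem, Finset.card_insert_of_notMem,
        Finset.card_insert_of_notMem, Finset.card_insert_of_notMem, Finset.card_insert_of_notMem,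
        Finset.card_singleton]
      · norm_num
      all_goals
        simp only [Finset.mem_insert, Finset.mem_singleton, Prod.mk.injEq]
        omega
  by_cases h4 : Δ = -4
  · obtain ⟨k, hk | hk⟩ := Int.even_or_odd' f.b
    swap
    · rw [hk] at hdisc; ring_nf at hdisc; omega
    refine ⟨{(1, 0), (-1, 0), (-k, 1), (k, -1)}, ?_, ?_⟩
    · rintro ⟨α, u⟩
      rw [key, iff_comm]
      simp only [Finset.mem_insert, Finset.mem_singleton, Prod.mk.injEq]
      constructor
      · intro h1
        have h0 := hsmall α u h1
        rcases h0 with rfl | ⟨-, rfl | rfl⟩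
        · have := (hzero α).1 h1
          omega
        · rw [hk, h4] at h1
          have := (hsq (2 * α + (2 * k)) 0).1 (by linear_combination h1)
          omega
        · rw [hk, h4] at h1
          have := (hsq (2 * α - (2 * k)) 0).1 (by linear_combination h1)
          omega
      · rw [hk, h4]
        rintro (⟨rfl, rfl⟩ | ⟨rfl, rfl⟩ | ⟨rfl, rfl⟩ | ⟨rfl, rfl⟩) <;> ring
    · rw [wNum, if_neg h3, if_pos h4, Finset.card_insert_of_notMem, Finset.card_insert_of_notMem,
        Finset.card_insert_of_notMem, Finset.card_singleton]
      · norm_num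
      all_goals
        simp only [Finset.mem_insert, Finset.mem_singleton, Prod.mk.injEq]
        omega
  · refine ⟨{(1, 0), (-1, 0)}, ?_, ?_⟩
    · rintro ⟨α, u⟩
      rw [key, iff_comm]
      simp only [Finset.mem_insert, Finset.mem_singleton, Prod.mk.injEq]
      constructor
      · intro h1
        have h0 := hsmall α u h1
        rcases h0 with rfl | ⟨h5, -⟩
        · have := (hzero α).1 h1
          omega
        · omega
      · rintro (⟨rfl, rfl⟩ | ⟨rfl, rfl⟩) <;> ring
    · rw [wNum, if_neg h3, if_neg h4, Finset.card_insert_of_notMem, Finset.card_singleton]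
      · norm_num
      · simp

/-- The automorph of `f` with parameters `(α, u)`. -/
def automorph (f : BinForm) (z : ℤ × ℤ) : Matrix (Fin 2) (Fin 2) ℤ :=
  !![z.1, -(f.c * z.2); f.a * z.2, z.1 + f.b * z.2]

theorem det_automorph (f : BinForm) (z : ℤ × ℤ) :
    (f.automorph z).det = z.1 ^ 2 + f.b * z.1 * z.2 + f.a * f.c * z.2 ^ 2 := by
  rw [automorph, Matrix.det_fin_two_of]; ring

theorem subst_automorph (f : BinForm) {z : ℤ × ℤ}
    (hz : z.1 ^ 2 + f.b * z.1 * z.2 + f.a * f.c * z.2 ^ 2 = 1) :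
    f.subst (f.automorph z) = f := by
  ext <;> simp [subst, automorph, eval]
  · linear_combination f.a * hz
  · linear_combination f.b * hz
  · linear_combination f.c * hz

theorem exists_eq_automorph {f : BinForm} (hf : f.IsPrimitive) {N : Matrix (Fin 2) (Fin 2) ℤ}
    (hN : N.det = 1) (h : f.subst N = f) : ∃ z : ℤ × ℤ, N = f.automorph z := by
  obtain ⟨u, h1, h2, h3⟩ := exists_of_subst_eq_det (K := N) hf (by simp [hN]) (by simpa [hN] using h)
  refine ⟨(N 0 0, u), ?_⟩
  ext i j
  fin_cases i <;> fin_cases j <;> simp [automorph, *]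

/-- Distinct automorphs differ at every nonzero vector: the difference of two of them has
determinant a quarter of a value of `x² - Δ y²`. -/
theorem OfDisc.automorph_act_injective {Δ : ℤ} {f : BinForm} (h : f.OfDisc Δ) {v : ℤ × ℤ}
    (hv : ¬(v.1 = 0 ∧ v.2 = 0)) : Function.Injective fun z => act (f.automorph z) v := by
  intro z z' hz
  simp only [act, automorph, Prod.mk.injEq, Matrix.of_apply, Matrix.cons_val', Matrix.cons_val_zero,
    Matrix.cons_val_one, Matrix.cons_val_fin_one] at hz
  obtain ⟨h1, h2⟩ := hz
  set s := z.1 - z'.1 with hs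
  set w := z.2 - z'.2 with hw
  have e1 : s * v.1 - f.c * w * v.2 = 0 := by rw [hs, hw]; linear_combination h1
  have e2 : f.a * w * v.1 + (s + f.b * w) * v.2 = 0 := by rw [hs, hw]; linear_combination h2
  have hD : (2 * s + f.b * w) ^ 2 - Δ * w ^ 2 = 0 := by
    rw [← h.disc_eq, disc]
    -- Cramer's rule for the singular system `e1`, `e2`
    have h3 : ((2 * s + f.b * w) ^ 2 - (f.b ^ 2 - 4 * f.a * f.c) * w ^ 2) * v.1 = 0 := by
      linear_combination 4 * (s + f.b * w) * e1 + 4 * f.c * w * e2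
    have h4 : ((2 * s + f.b * w) ^ 2 - (f.b ^ 2 - 4 * f.a * f.c) * w ^ 2) * v.2 = 0 := by
      linear_combination 4 * s * e2 - 4 * f.a * w * e1
    by_contra h0
    exact hv ⟨(mul_eq_zero.1 h3).resolve_left h0, (mul_eq_zero.1 h4).resolve_left h0⟩
  have hneg := h.disc_neg
  have hw0 : w = 0 := by
    by_contra h0
    have : 0 < w ^ 2 := by positivity
    nlinarith [sq_nonneg (2 * s + f.b * w)]
  rw [hw0] at hD
  have hs0 : s = 0 := by
    have : s ^ 2 = 0 := by linarith
    exact pow_eq_zero_iff two_ne_zero |>.1 this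
  exact Prod.ext (by omega) (by omega)

/-! ### Representation numbers of a form and of its restriction to a lattice of index `p` -/

/-- If `f` restricts to the primitive form `F` on a lattice of index `p`, then a vector of the
lattice at which the form is divisible by `p` lies in `p ℤ²`. -/
theorem exists_act_adjugate_eq {f F : BinForm} (hF : F.IsPrimitive) {p : ℤ} (hp : Prime p)
    {M : Matrix (Fin 2) (Fin 2) ℤ} (hM : M.det = p) (hf : f.subst M = F)
    {x : ℤ × ℤ} (hx : p ∣ F.eval x.1 x.2) : ∃ v : ℤ × ℤ, x = act M.adjugate v := by
  suffices h : p ∣ (act M x).1 ∧ p ∣ (act M x).2 by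
    obtain ⟨⟨v1, h1⟩, ⟨v2, h2⟩⟩ := h
    refine ⟨(v1, v2), ?_⟩
    have h3 := act_adjugate_act M x
    rw [hM, Prod.ext_iff] at h3
    obtain ⟨h3, h4⟩ := h3
    dsimp only [act] at h1 h2 h3 h4 ⊢
    rw [h1, h2] at h3 h4
    ext <;> apply mul_left_cancel₀ hp.ne_zero
    · linear_combination -h3
    · linear_combination -h4
  rw [← hf, ← eval_act] at hx
  rw [Matrix.det_fin_two] at hM
  have hA : f.eval (M 0 0) (M 1 0) = F.a := by rw [← hf]; rfl
  have hC : f.eval (M 0 1) (M 1 1) = F.c := by rw [← hf]; rfl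
  -- a column of `M` at which `f` is prime to `p` spans the image of `M` modulo `p`
  have hcol : ∀ y : ℤ × ℤ, ¬ p ∣ f.eval y.1 y.2 → p ∣ y.1 * (act M x).2 - y.2 * (act M x).1 →
      p ∣ (act M x).1 ∧ p ∣ (act M x).2 := by
    rintro y hy ⟨k, hk⟩
    set v := act M x
    obtain ⟨e, he⟩ := hx
    have h1 : p ∣ v.1 ^ 2 * f.eval y.1 y.2 := by
      refine ⟨y.1 ^ 2 * e - k * (f.b * y.1 * v.1 + f.c * (y.1 * v.2 + y.2 * v.1)), ?_⟩
      simp only [eval] at he ⊢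
      linear_combination y.1 ^ 2 * he - (f.b * y.1 * v.1 + f.c * (y.1 * v.2 + y.2 * v.1)) * hk
    have h2 : p ∣ v.2 ^ 2 * f.eval y.1 y.2 := by
      refine ⟨y.2 ^ 2 * e + k * (f.b * y.2 * v.2 + f.a * (y.1 * v.2 + y.2 * v.1)), ?_⟩
      simp only [eval] at he ⊢
      linear_combination y.2 ^ 2 * he + (f.b * y.2 * v.2 + f.a * (y.1 * v.2 + y.2 * v.1)) * hk
    exact ⟨hp.dvd_of_dvd_pow ((hp.dvd_or_dvd h1).resolve_right hy),
      hp.dvd_of_dvd_pow ((hp.dvd_or_dvd h2).resolve_right hy)⟩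
  by_cases ha : p ∣ F.a
  · have hc : ¬ p ∣ F.c := fun hc => by
      have hb : p ∣ F.b ^ 2 := by
        have h1 := disc_subst f M
        rw [hf, Matrix.det_fin_two, hM] at h1
        obtain ⟨k, hk⟩ := ha
        refine ⟨p * f.disc + 4 * k * F.c, ?_⟩
        simp only [disc] at h1 ⊢
        linear_combination h1 + 4 * F.c * hk
      exact hp.not_isUnit (hF p ha (hp.dvd_of_dvd_pow hb) hc)
    refine hcol (M 0 1, M 1 1) (by rwa [← hC] at hc) ⟨-x.1, ?_⟩
    dsimp only [act]
    linear_combination (-x.1) * hM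
  · refine hcol (M 0 0, M 1 0) (by rwa [← hA] at ha) ⟨x.2, ?_⟩
    dsimp only [act]
    linear_combination x.2 * hM

/-- The bijection sends a representation `v` by `f` to `adj M v`, which is `p M⁻¹ v`. -/
theorem card_eval_eq_sq_mul {f F : BinForm} (hF : F.IsPrimitive) {p : ℤ} (hp : Prime p)
    {M : Matrix (Fin 2) (Fin 2) ℤ} (hM : M.det = p) (hf : f.subst M = F) (m : ℤ) :
    Nat.card {x : ℤ × ℤ // F.eval x.1 x.2 = p ^ 2 * m} =
      Nat.card {v : ℤ × ℤ // f.eval v.1 v.2 = m} := by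
  have hadj : ∀ v : ℤ × ℤ, F.eval (act M.adjugate v).1 (act M.adjugate v).2 =
      p ^ 2 * f.eval v.1 v.2 := fun v => by
    rw [eval_act, subst_adjugate_of_subst_eq hf, hM]
    simp only [eval]; ring
  symm
  refine Nat.card_congr (Equiv.ofBijective
    (fun v => ⟨act M.adjugate v.1, by rw [hadj, v.2]⟩) ⟨?_, ?_⟩)
  · intro v w hvw
    have hdet : M.adjugate.det ≠ 0 := by
      rw [Matrix.det_adjugate, hM]; exact pow_ne_zero _ hp.ne_zero
    exact Subtype.ext (act_injective hdet (congrArg Subtype.val hvw))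
  · rintro ⟨x, hx⟩
    obtain ⟨v, rfl⟩ := exists_act_adjugate_eq (x := x) hF hp hM hf ⟨p * m, by rw [hx]; ring⟩
    refine ⟨⟨v, ?_⟩, rfl⟩
    rw [hadj] at hx
    exact mul_left_cancel₀ (pow_ne_zero 2 hp.ne_zero) hx

theorem sq_dvd_of_dvd_eval {f F : BinForm} (hF : F.IsPrimitive) {p : ℤ} (hp : Prime p)
    {M : Matrix (Fin 2) (Fin 2) ℤ} (hM : M.det = p) (hf : f.subst M = F) {x : ℤ × ℤ}
    (hx : p ∣ F.eval x.1 x.2) : p ^ 2 ∣ F.eval x.1 x.2 := by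
  obtain ⟨v, rfl⟩ := exists_act_adjugate_eq hF hp hM hf hx
  refine ⟨f.eval v.1 v.2, ?_⟩
  rw [eval_act, subst_adjugate_of_subst_eq hf, hM]
  simp only [eval]; ring

/-- If every representation of `n` by `f` comes from an embedding of index `p` of `F` into `f`,
then the relation "some embedding maps `x` to `v`" between the representations of `n` by `F` and by
`f` is `2w` to `2`: the embeddings are permuted simply transitively by the `2w` automorphs of `f`,
and the vector `v` determines `x` up to sign. -/
theorem wNum_mul_card_eval_eq {Δ : ℤ} {f F : BinForm} {p : ℤ} (hf : f.OfDisc Δ)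
    (hF : F.OfDisc (Δ * p ^ 2)) (hp : Prime p) {M : Matrix (Fin 2) (Fin 2) ℤ} (hM : M.det = p)
    (hMF : f.subst M = F) {n : ℤ} (hn : ¬ p ∣ n)
    (hsurj : ∀ v : ℤ × ℤ, f.eval v.1 v.2 = n → ∃ M' : Matrix (Fin 2) (Fin 2) ℤ,
      M'.det = p ∧ f.subst M' = F ∧ ∃ x, act M' x = v) :
    wNum Δ * Nat.card {x : ℤ × ℤ // F.eval x.1 x.2 = n} =
      Nat.card {v : ℤ × ℤ // f.eval v.1 v.2 = n} := by
  classical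
  obtain ⟨A, hA, hAcard⟩ := hf.exists_automorph_params
  set S := (hF.finite_eval_eq n).toFinset
  set T := (hf.finite_eval_eq n).toFinset
  have hS : ∀ x : ℤ × ℤ, x ∈ S ↔ F.eval x.1 x.2 = n := fun x => by simp [S]
  have hT : ∀ x : ℤ × ℤ, x ∈ T ↔ f.eval x.1 x.2 = n := fun x => by simp [T]
  rw [Nat.subtype_card S hS, Nat.subtype_card T hT]
  have hn0 : n ≠ 0 := fun h => hn (h ▸ dvd_zero p)
  have hF4 : F.disc < -4 := by
    rw [hF.disc_eq]
    have h1 := hf.disc_neg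
    have h2 := hf.disc_emod_four
    have h3 : 2 ≤ |p| := by
      have := hp.not_isUnit
      have h0 := hp.ne_zero
      rw [Int.isUnit_iff_abs_eq] at this
      have := abs_pos.2 h0
      omega
    have h4 : 4 ≤ p ^ 2 := by rw [← sq_abs]; nlinarith
    nlinarith [show Δ ≤ -3 by omega]
  let R : ℤ × ℤ → ℤ × ℤ → Prop := fun x v =>
    ∃ M' : Matrix (Fin 2) (Fin 2) ℤ, M'.det = p ∧ f.subst M' = F ∧ act M' x = v
  have hd : S.card * A.card = T.card * 2 := by
    apply Finset.card_mul_eq_card_mul R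
    · intro x hx
      rw [hS] at hx
      have hy : ¬((act M x).1 = 0 ∧ (act M x).2 = 0) := fun ⟨h1, h2⟩ => hn0 <| by
        rw [← hx, ← hMF, ← eval_act, h1, h2]; simp [eval]
      rw [← Finset.card_image_of_injective A (hf.automorph_act_injective hy)]
      congr 1
      ext v
      simp only [Finset.mem_bipartiteAbove, Finset.mem_image, hT, R]
      constructor
      · rintro ⟨-, M', h1, h2, rfl⟩
        obtain ⟨N, hN, hNf, rfl⟩ := exists_automorph_of_subst_eq hf.primitive hF.primitive
          (by rw [hf.disc_eq]; exact hf.disc_neg.ne) hp.ne_zero hM h1 hMF h2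
        obtain ⟨z, rfl⟩ := exists_eq_automorph hf.primitive hN hNf
        rw [det_automorph] at hN
        exact ⟨z, (hA z).2 hN, (act_mul _ _ _).symm⟩
      · rintro ⟨z, hz, rfl⟩
        rw [hA] at hz
        refine ⟨?_, f.automorph z * M, ?_, ?_, act_mul _ _ _⟩
        · rw [eval_act, subst_automorph f hz, eval_act, hMF, hx]
        · rw [Matrix.det_mul, det_automorph, hz, hM, one_mul]
        · rw [subst_mul, subst_automorph f hz, hMF]
    · intro v hv
      rw [hT] at hv
      obtain ⟨M', h1, h2, x, rfl⟩ := hsurj v hv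
      rw [eval_act, h2] at hv
      have hx0 : x ≠ -x := fun h => hn0 <| by
        have e1 : x.1 = 0 := by have := congrArg Prod.fst h; simp at this; omega
        have e2 : x.2 = 0 := by have := congrArg Prod.snd h; simp at this; omega
        rw [← hv, e1, e2]; simp [eval]
      rw [← Finset.card_pair hx0]
      congr 1
      ext y
      simp only [Finset.mem_bipartiteBelow, Finset.mem_insert, Finset.mem_singleton, hS, R]
      constructor
      · rintro ⟨-, M'', h3, h4, h5⟩
        exact eq_or_eq_neg_of_act_eq hF.primitive hF4 hp h3 h1 h4 h2 h5 (by rwa [hv])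
      · rintro (rfl | rfl)
        · exact ⟨hv, M', h1, h2, rfl⟩
        · refine ⟨by rw [← hv]; simp [eval], -M', ?_, ?_, ?_⟩
          · rw [Matrix.det_neg]; simp [h1]
          · rw [← h2]; simp [subst, eval]
          · simp [act]
  have hd' : (S.card : ℚ) * A.card = T.card * 2 := by exact_mod_cast hd
  rw [hAcard] at hd'
  linarith

/-! ### Characters of represented integers -/

theorem four_mul_eval_mul_eval (f : BinForm) (x y z w : ℤ) :
    4 * (f.eval x y * f.eval z w) = (2 * f.a * x * z + f.b * (x * w + y * z) + 2 * f.c * y * w) ^ 2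
      - f.disc * (x * w - y * z) ^ 2 := by
  simp only [eval, disc]; ring

theorem Represents.four_mul_mul {H : BinForm} {Δ m r s : ℤ} (hH : H.disc = Δ * m ^ 2)
    (hr : H.Represents r) (hs : H.Represents s) :
    ∃ X Y : ℤ, 4 * (r * s) = X ^ 2 - Δ * (m * Y) ^ 2 := by
  obtain ⟨x, y, rfl⟩ := hr
  obtain ⟨z, w, rfl⟩ := hs
  refine ⟨2 * H.a * x * z + H.b * (x * w + y * z) + 2 * H.c * y * w, x * w - y * z,
    (four_mul_eval_mul_eval H x y z w).trans ?_⟩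
  rw [hH]; ring

/-- For even discriminants the factor `4` cancels from `Represents.four_mul_mul`. -/
theorem Represents.mul_eq_of_even {H : BinForm} {D m r s : ℤ} (hH : H.disc = 4 * D * m ^ 2)
    (hr : H.Represents r) (hs : H.Represents s) : ∃ X Y : ℤ, r * s = X ^ 2 - D * (m * Y) ^ 2 := by
  obtain ⟨X, Y, h⟩ := hr.four_mul_mul hH hs
  obtain ⟨X', rfl⟩ : (2 : ℤ) ∣ X := by
    apply Int.prime_two.dvd_of_dvd_pow (n := 2)
    exact ⟨2 * (r * s) + 2 * D * (m * Y) ^ 2, by linear_combination -h⟩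
  exact ⟨X', Y, by linarith⟩

theorem legendreSym_eq_of_four_mul_mul {q : ℕ} [Fact q.Prime] (hq : q ≠ 2) {r s X k : ℤ}
    (h : 4 * (r * s) = X ^ 2 - q * k) (hr : ¬ (q : ℤ) ∣ r) (hs : ¬ (q : ℤ) ∣ s) :
    legendreSym q r = legendreSym q s := by
  have hr' : (r : ZMod q) ≠ 0 := fun h0 => hr ((ZMod.intCast_zmod_eq_zero_iff_dvd r q).1 h0)
  have hs' : (s : ZMod q) ≠ 0 := fun h0 => hs ((ZMod.intCast_zmod_eq_zero_iff_dvd s q).1 h0)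
  have h2 : ((2 : ℤ) : ZMod q) ≠ 0 := fun h0 => by
    have h1 := (ZMod.intCast_zmod_eq_zero_iff_dvd 2 q).1 h0
    exact hq ((Nat.prime_dvd_prime_iff_eq (Fact.out : q.Prime) Nat.prime_two).1
      (by exact_mod_cast h1))
  have hX : ((X ^ 2 : ℤ) : ZMod q) = ((2 ^ 2 * (r * s) : ℤ) : ZMod q) := by
    have : X ^ 2 = 2 ^ 2 * (r * s) + q * k := by linarith
    rw [this]; push_cast; simp
  have hX0 : (X : ZMod q) ≠ 0 := fun h0 => by
    have h1 : ((2 : ℤ) : ZMod q) ^ 2 * (r * s) = 0 := by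
      have := hX.symm
      rw [Int.cast_mul, Int.cast_pow, Int.cast_mul, Int.cast_pow, h0] at this
      simpa using this
    exact mul_ne_zero (pow_ne_zero 2 h2) (mul_ne_zero hr' hs') h1
  have hL : legendreSym q (X ^ 2) = legendreSym q (2 ^ 2 * (r * s)) := by
    unfold legendreSym; rw [hX]
  rw [legendreSym.sq_one' q hX0, legendreSym.mul, legendreSym.sq_one' q h2, one_mul,
    legendreSym.mul] at hL
  rcases legendreSym.eq_one_or_neg_one q hr' with h3 | h3 <;>
    rcases legendreSym.eq_one_or_neg_one q hs' with h4 | h4 <;> rw [h3, h4] at hL ⊢ <;> simp at hL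

theorem mul_self_eq_one_zmod_eight {r : ℤ} (hr : r % 2 = 1) : (r : ZMod 8) * r = 1 := by
  have h1 : r % 8 = 1 ∨ r % 8 = 3 ∨ r % 8 = 5 ∨ r % 8 = 7 := by omega
  have h2 : r * r ≡ 1 [ZMOD 8] := by
    rcases h1 with h | h | h | h <;> simp [Int.ModEq, Int.mul_emod, h]
  have := (ZMod.intCast_eq_intCast_iff _ _ 8).2 h2
  simpa using this

theorem mul_self_eq_one_zmod_four {r : ℤ} (hr : r % 2 = 1) : (r : ZMod 4) * r = 1 := by
  have h1 : r % 4 = 1 ∨ r % 4 = 3 := by omega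
  have h2 : r * r ≡ 1 [ZMOD 4] := by
    rcases h1 with h | h <;> simp [Int.ModEq, Int.mul_emod, h]
  have := (ZMod.intCast_eq_intCast_iff _ _ 4).2 h2
  simpa using this

theorem emod_two_eq_one_of_isCoprime {r Δ : ℤ} (h : IsCoprime r Δ) (hΔ : Δ % 2 = 0) :
    r % 2 = 1 := by
  have h1 : IsCoprime r 2 := h.of_isCoprime_of_dvd_right (Int.dvd_of_emod_eq_zero hΔ)
  have h2 := Int.isCoprime_iff_gcd_eq_one.1 h1
  by_contra h3
  have h4 : (2 : ℤ) ∣ Int.gcd r 2 := Int.dvd_coe_gcd (by omega) dvd_rfl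
  rw [h2] at h4
  norm_num at h4

theorem chi_four_eq {r s X Y D : ZMod 4} (hr : r * r = 1) (hs : s * s = 1)
    (h : r * s = X ^ 2 - D * Y ^ 2) (hD : D = 0 ∨ D = 3) : ZMod.χ₄ r = ZMod.χ₄ s := by
  have h1 : ∀ X Y : ZMod 4, ∀ D : ZMod 4, (D = 0 ∨ D = 3) → X ^ 2 - D * Y ^ 2 ≠ 3 := by decide
  have h2 : ∀ r s : ZMod 4, r * r = 1 → s * s = 1 → r * s ≠ 3 → ZMod.χ₄ r = ZMod.χ₄ s := by decide
  exact h2 r s hr hs (h ▸ h1 X Y D hD)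

theorem chi_eight_eq {r s X Y D : ZMod 8} (hr : r * r = 1) (hs : s * s = 1)
    (h : r * s = X ^ 2 - D * Y ^ 2) (hD : D = 0 ∨ D = 2) : ZMod.χ₈ r = ZMod.χ₈ s := by
  have h1 : ∀ X Y : ZMod 8, X ^ 2 - 0 * Y ^ 2 ≠ 3 ∧ X ^ 2 - 0 * Y ^ 2 ≠ 5 ∧
      X ^ 2 - 2 * Y ^ 2 ≠ 3 ∧ X ^ 2 - 2 * Y ^ 2 ≠ 5 := by decide
  have h2 : ∀ r s : ZMod 8, r * r = 1 → s * s = 1 → r * s ≠ 3 → r * s ≠ 5 →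
      ZMod.χ₈ r = ZMod.χ₈ s := by decide
  obtain ⟨a, b, c, d⟩ := h1 X Y
  rcases hD with rfl | rfl
  · exact h2 r s hr hs (h ▸ a) (h ▸ b)
  · exact h2 r s hr hs (h ▸ c) (h ▸ d)

theorem chi_eight'_eq {r s X Y : ZMod 8} (hr : r * r = 1) (hs : s * s = 1)
    (h : r * s = X ^ 2 - 6 * Y ^ 2) : ZMod.χ₈' r = ZMod.χ₈' s := by
  have h1 : ∀ X Y : ZMod 8, X ^ 2 - 6 * Y ^ 2 ≠ 5 ∧ X ^ 2 - 6 * Y ^ 2 ≠ 7 := by decide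
  have h2 : ∀ r s : ZMod 8, r * r = 1 → s * s = 1 → r * s ≠ 5 → r * s ≠ 7 →
      ZMod.χ₈' r = ZMod.χ₈' s := by decide
  obtain ⟨a, b⟩ := h1 X Y
  exact h2 r s hr hs (h ▸ a) (h ▸ b)

theorem chi_eight_eq_of_chi_eight' {r s : ℤ} (hr : r % 2 = 1) (hs : s % 2 = 1)
    (h4 : r ≡ s [ZMOD 4]) (h : ZMod.χ₈' (r : ZMod 8) = ZMod.χ₈' (s : ZMod 8)) :
    ZMod.χ₈ (r : ZMod 8) = ZMod.χ₈ (s : ZMod 8) := by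
  have h1 : ∀ r s : ZMod 8, r * r = 1 → s * s = 1 → 2 * r = 2 * s → ZMod.χ₈' r = ZMod.χ₈' s →
      ZMod.χ₈ r = ZMod.χ₈ s := by decide
  refine h1 _ _ (mul_self_eq_one_zmod_eight hr) (mul_self_eq_one_zmod_eight hs) ?_ h
  have h2 : 2 * r ≡ 2 * s [ZMOD 8] := by
    rw [Int.ModEq] at h4 ⊢; omega
  have := (ZMod.intCast_eq_intCast_iff _ _ 8).2 h2
  simpa using this

theorem not_natCast_dvd_of_isCoprime {q : ℕ} (hq : q.Prime) {r m : ℤ} (h : IsCoprime r m)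
    (hm : (q : ℤ) ∣ m) : ¬ (q : ℤ) ∣ r := fun hr =>
  (Nat.prime_iff_prime_int.1 hq).not_isUnit (h.isUnit_of_dvd' hr hm)

/-- The assigned characters of `Δ` are constant on the integers coprime to `Δ` represented by a
form whose discriminant is `Δ` times a square: the product of two such integers is a value
`(X² - Δ Y²) / 4` of the principal form. -/
theorem assignedCharacter_eq {H : BinForm} {Δ m r s : ℤ} (hH : H.disc = Δ * m ^ 2)
    (hr : H.Represents r) (hs : H.Represents s) (hrΔ : IsCoprime r Δ) (hsΔ : IsCoprime s Δ)
    {χ : ℤ → ℤ} (hχ : IsAssignedCharacter Δ χ) : χ r = χ s := by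
  have key : Δ % 4 = 0 → ∃ X Y : ℤ, r * s = X ^ 2 - (Δ / 4) * Y ^ 2 := fun h4 => by
    obtain ⟨X, Y, h⟩ := hr.mul_eq_of_even (D := Δ / 4) (by rw [hH]; congr 1; omega) hs
    exact ⟨X, _, h⟩
  cases hχ with
  | odd_prime q hq hd =>
    obtain ⟨X, Y, h⟩ := hr.four_mul_mul hH hs
    obtain ⟨k, rfl⟩ := hd
    exact legendreSym_eq_of_four_mul_mul (X := X) hq (k := k * (m * Y) ^ 2) (by linear_combination h)
      (not_natCast_dvd_of_isCoprime Fact.out hrΔ (dvd_mul_right _ _))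
      (not_natCast_dvd_of_isCoprime Fact.out hsΔ (dvd_mul_right _ _))
  | neg_one h =>
    obtain ⟨X, Y, hXY⟩ := key (by omega)
    have hD : ((Δ / 4 : ℤ) : ZMod 4) = 0 ∨ ((Δ / 4 : ℤ) : ZMod 4) = 3 := by
      rcases (show Δ / 4 % 4 = 0 ∨ Δ / 4 % 4 = 3 by omega) with h1 | h1
      · left; exact_mod_cast (ZMod.intCast_eq_intCast_iff (Δ / 4) 0 4).2 h1
      · right; exact_mod_cast (ZMod.intCast_eq_intCast_iff (Δ / 4) 3 4).2 h1
    have hc := congrArg (Int.cast : ℤ → ZMod 4) hXY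
    push_cast at hc
    exact chi_four_eq
      (mul_self_eq_one_zmod_four (emod_two_eq_one_of_isCoprime hrΔ (by omega)))
      (mul_self_eq_one_zmod_four (emod_two_eq_one_of_isCoprime hsΔ (by omega))) hc hD
  | two h =>
    obtain ⟨X, Y, hXY⟩ := key (by omega)
    have hD : ((Δ / 4 : ℤ) : ZMod 8) = 0 ∨ ((Δ / 4 : ℤ) : ZMod 8) = 2 := by
      rcases (show Δ / 4 % 8 = 0 ∨ Δ / 4 % 8 = 2 by omega) with h1 | h1
      · left; exact_mod_cast (ZMod.intCast_eq_intCast_iff (Δ / 4) 0 8).2 h1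
      · right; exact_mod_cast (ZMod.intCast_eq_intCast_iff (Δ / 4) 2 8).2 h1
    have hc := congrArg (Int.cast : ℤ → ZMod 8) hXY
    push_cast at hc
    exact chi_eight_eq
      (mul_self_eq_one_zmod_eight (emod_two_eq_one_of_isCoprime hrΔ (by omega)))
      (mul_self_eq_one_zmod_eight (emod_two_eq_one_of_isCoprime hsΔ (by omega))) hc hD
  | neg_two h =>
    obtain ⟨X, Y, hXY⟩ := key (by omega)
    have hD : ((Δ / 4 : ℤ) : ZMod 8) = 6 := by
      exact_mod_cast (ZMod.intCast_eq_intCast_iff (Δ / 4) 6 8).2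
        (show Δ / 4 % 8 = 6 % 8 by omega)
    have hc := congrArg (Int.cast : ℤ → ZMod 8) hXY
    push_cast at hc
    rw [hD] at hc
    exact chi_eight'_eq
      (mul_self_eq_one_zmod_eight (emod_two_eq_one_of_isCoprime hrΔ (by omega)))
      (mul_self_eq_one_zmod_eight (emod_two_eq_one_of_isCoprime hsΔ (by omega))) hc

/-- The integers `r` and `n`, prime to `p`, are not separated by the characters modulo `p` that
are constant on the values of the forms of discriminant `Δ p²`: the Legendre symbol for odd `p`,
and the residue modulo `2 ^ (t + 1)` for `p = 2`. -/
def SameResidue (Δ : ℤ) (p : ℕ) [Fact p.Prime] (r n : ℤ) : Prop :=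
  (p ≠ 2 → legendreSym p r = legendreSym p n) ∧
    (p = 2 → r ≡ n [ZMOD 2 ^ (tNum Δ + 1)])

theorem SameResidue.trans {Δ : ℤ} {p : ℕ} [Fact p.Prime] {r n s : ℤ} (h : SameResidue Δ p r n)
    (h' : SameResidue Δ p n s) : SameResidue Δ p r s :=
  ⟨fun hp => (h.1 hp).trans (h'.1 hp), fun hp => (h.2 hp).trans (h'.2 hp)⟩

/-- For `p = 2` the product of two represented odd integers has the form `X² - Δ Y²`. -/
theorem Represents.sameResidue {H : BinForm} {Δ : ℤ} {p : ℕ} [Fact p.Prime] {r n : ℤ}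
    (hH : H.disc = Δ * (p : ℤ) ^ 2) (hΔ : Δ % 4 = 0 ∨ Δ % 4 = 1)
    (hr : H.Represents r) (hn : H.Represents n)
    (hpr : ¬ (p : ℤ) ∣ r) (hpn : ¬ (p : ℤ) ∣ n) : SameResidue Δ p r n := by
  constructor
  · intro hp
    obtain ⟨X, Y, h⟩ := hr.four_mul_mul hH hn
    exact legendreSym_eq_of_four_mul_mul (X := X) hp (k := Δ * p * Y ^ 2)
      (by linear_combination h) hpr hpn
  · rintro rfl
    obtain ⟨X, Y, h⟩ := hr.mul_eq_of_even (D := Δ) (m := 1) (by rw [hH]; push_cast; ring) hn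
    have hr2 : r % 2 = 1 := by push_cast at hpr; omega
    have hn2 : n % 2 = 1 := by push_cast at hpn; omega
    rw [one_mul] at h
    have hrn : r * n % 2 = 1 := by rw [Int.mul_emod, hr2, hn2]; rfl
    have hX : Δ % 2 = 0 → X % 2 = 1 := fun h2 => by
      obtain ⟨D, rfl⟩ := Int.dvd_of_emod_eq_zero h2
      have h3 : X ^ 2 % 2 = 1 := by
        have : X ^ 2 = r * n + 2 * (D * Y ^ 2) := by rw [h]; ring
        omega
      rcases Int.emod_two_eq_zero_or_one X with h4 | h4
      · rw [pow_two, Int.mul_emod, h4] at h3; norm_num at h3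
      · exact h4
    have hX8 : Δ % 2 = 0 → X ^ 2 % 8 = 1 := fun h2 => by
      have h1 := hX h2
      have h3 : X % 8 = 1 ∨ X % 8 = 3 ∨ X % 8 = 5 ∨ X % 8 = 7 := by omega
      rcases h3 with h3 | h3 | h3 | h3 <;> rw [pow_two, Int.mul_emod, h3] <;> rfl
    unfold tNum
    split_ifs with h16 h2
    · obtain ⟨D, rfl⟩ := h16
      have hm : r * n % 8 = 1 := by
        have h3 := hX8 (by omega)
        have : r * n = X ^ 2 - 8 * (2 * D * Y ^ 2) := by rw [h]; ring
        omega
      have h5 : r % 8 = 1 ∨ r % 8 = 3 ∨ r % 8 = 5 ∨ r % 8 = 7 := by omega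
      rw [Int.ModEq]
      norm_num
      rcases h5 with h5 | h5 | h5 | h5 <;> rw [Int.mul_emod, h5] at hm <;> omega
    · obtain ⟨D, rfl⟩ : (4 : ℤ) ∣ Δ := by omega
      have hm : r * n % 4 = 1 := by
        have h3 := hX8 (by omega)
        have : r * n = X ^ 2 - 4 * (D * Y ^ 2) := by rw [h]; ring
        omega
      have h5 : r % 4 = 1 ∨ r % 4 = 3 := by omega
      rw [Int.ModEq]
      norm_num
      rcases h5 with h5 | h5 <;> rw [Int.mul_emod, h5] at hm <;> omega
    · rw [Int.ModEq]
      norm_num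
      omega

theorem odd_sq_emod {p : ℕ} (hp : p.Prime) (h2 : p ≠ 2) :
    ((p : ℤ) ^ 2) % 32 = 1 ∨ ((p : ℤ) ^ 2) % 32 = 9 ∨ ((p : ℤ) ^ 2) % 32 = 17 ∨
      ((p : ℤ) ^ 2) % 32 = 25 := by
  have h1 : p % 2 = 1 := hp.eq_two_or_odd.resolve_left h2
  obtain ⟨k, hk⟩ : ∃ k : ℤ, (p : ℤ) = 2 * k + 1 := ⟨(p : ℤ) / 2, by omega⟩
  obtain ⟨l, hl⟩ := Int.even_mul_succ_self k
  have : (p : ℤ) ^ 2 = 8 * l + 1 := by rw [hk]; linear_combination 4 * hl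
  omega

/-- The assigned characters of `Δ p²` are determined by those of `Δ` together with the residue
condition at `p`. For `p = 2` and `Δ ≡ 24 mod 32` this uses `(2/r) = (-1/r)(-2/r)`. -/
theorem assignedCharacter_mul_sq_eq {Δ : ℤ} {p : ℕ} [hp : Fact p.Prime] {r n : ℤ}
    (hΔ : Δ % 4 = 0 ∨ Δ % 4 = 1) (hr : IsCoprime r (Δ * (p : ℤ) ^ 2))
    (hn : IsCoprime n (Δ * (p : ℤ) ^ 2)) (h : ∀ χ, IsAssignedCharacter Δ χ → χ r = χ n)
    (hrn : SameResidue Δ p r n) {χ : ℤ → ℤ} (hχ : IsAssignedCharacter (Δ * (p : ℤ) ^ 2) χ) :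
    χ r = χ n := by
  cases hχ with
  | odd_prime q hq hd =>
    by_cases hqΔ : (q : ℤ) ∣ Δ
    · exact h _ (.odd_prime q hq hqΔ)
    · have hqp : Prime (q : ℤ) := Nat.prime_iff_prime_int.1 Fact.out
      have h1 := hqp.dvd_of_dvd_pow ((hqp.dvd_or_dvd hd).resolve_left hqΔ)
      obtain rfl := (Nat.prime_dvd_prime_iff_eq Fact.out hp.out).1 (Int.natCast_dvd_natCast.1 h1)
      exact hrn.1 hq
  | neg_one h1 =>
    by_cases hp2 : p = 2
    · subst hp2
      push_cast at h1
      by_cases h2 : Δ % 16 = 12 ∨ Δ % 16 = 0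
      · exact h _ (.neg_one h2)
      · have h3 := hrn.2 rfl
        rw [tNum, if_neg (by omega), if_pos (by omega)] at h3
        exact congrArg ZMod.χ₄ ((ZMod.intCast_eq_intCast_iff r n 4).2 h3)
    · refine h _ (.neg_one ?_)
      have h2 : (p : ℤ) ^ 2 % 16 = 1 ∨ (p : ℤ) ^ 2 % 16 = 9 := by
        have := odd_sq_emod hp.out hp2
        omega
      rcases h2 with h2 | h2 <;> rw [Int.mul_emod, h2] at h1 <;> omega
  | two h1 =>
    by_cases hp2 : p = 2
    · subst hp2
      push_cast at h1
      by_cases h2 : Δ % 32 = 8 ∨ Δ % 32 = 0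
      · exact h _ (.two h2)
      · have h3 := hrn.2 rfl
        have hr2 := emod_two_eq_one_of_isCoprime hr (by push_cast; omega)
        have hn2 := emod_two_eq_one_of_isCoprime hn (by push_cast; omega)
        by_cases h4 : Δ % 32 = 24
        · rw [tNum, if_neg (by omega), if_pos (by omega)] at h3
          exact chi_eight_eq_of_chi_eight' hr2 hn2 h3 (h _ (.neg_two h4))
        · rw [tNum, if_pos (by omega)] at h3
          exact congrArg ZMod.χ₈ ((ZMod.intCast_eq_intCast_iff r n 8).2 h3)
    · refine h _ (.two ?_)
      rcases odd_sq_emod hp.out hp2 with h2 | h2 | h2 | h2 <;> rw [Int.mul_emod, h2] at h1 <;> omega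
  | neg_two h1 =>
    by_cases hp2 : p = 2
    · subst hp2
      push_cast at h1
      omega
    · refine h _ (.neg_two ?_)
      rcases odd_sq_emod hp.out hp2 with h2 | h2 | h2 | h2 <;> rw [Int.mul_emod, h2] at h1 <;> omega

/-- A form of discriminant `Δ p²` with the characters of `Δ` and the residue at `p` of `r`, an
integer represented by `F`, lies in the genus of `F`. -/
theorem mem_genus_of_sameResidue {Δ : ℤ} {p : ℕ} [hp : Fact p.Prime] {F h : BinForm} {r n : ℤ}
    (hΔ : Δ % 4 = 0 ∨ Δ % 4 = 1)
    (hr : IsCoprime r (Δ * (p : ℤ) ^ 2)) (hFr : F.Represents r) (hh : h.OfDisc (Δ * (p : ℤ) ^ 2))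
    (hn : h.Represents n) (hpn : ¬ (p : ℤ) ∣ n) (hrn : SameResidue Δ p r n)
    (hχ : ∀ χ, IsAssignedCharacter Δ χ → ∀ s, IsCoprime s Δ → h.Represents s → χ r = χ s) :
    h ∈ genus (Δ * (p : ℤ) ^ 2) F := by
  obtain ⟨s, hs, hsc⟩ := hh.primitive.exists_represents_isCoprime hh.disc_neg.ne
  have hps : ¬ (p : ℤ) ∣ s :=
    not_natCast_dvd_of_isCoprime hp.out hsc ((dvd_pow_self _ two_ne_zero).mul_left _)
  refine ⟨hh, r, s, hr, hsc, hFr, hs, fun χ hχ' => ?_⟩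
  exact assignedCharacter_mul_sq_eq hΔ hr hsc (fun χ h' => hχ χ h' s hsc.of_mul_right_left hs)
    (hrn.trans (hn.sameResidue hh.disc_eq hΔ hs hpn hps)) hχ'

/-! ### Embeddings of index `p` -/

theorem subst_diag (f : BinForm) (k : ℤ) :
    f.subst !![1, 0; 0, k] = ⟨f.a, f.b * k, f.c * k ^ 2⟩ := by
  ext <;> simp [subst, eval]

/-- A form of discriminant `Δ p²` with first coefficient prime to `p` becomes `(a, bp, cp²)` after a
translation. -/
theorem exists_shift_dvd {F : BinForm} {Δ : ℤ} {p : ℕ} (hp : p.Prime)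
    (hΔ : Δ % 4 = 0 ∨ Δ % 4 = 1) (hF : F.disc = Δ * (p : ℤ) ^ 2) (ha : ¬ (p : ℤ) ∣ F.a) :
    ∃ k : ℤ, (p : ℤ) ∣ 2 * F.a * k + F.b ∧ (p : ℤ) ^ 2 ∣ F.a * k ^ 2 + F.b * k + F.c := by
  have hpp : Prime (p : ℤ) := Nat.prime_iff_prime_int.1 hp
  rw [disc] at hF
  by_cases h2 : p = 2
  · subst h2
    push_cast at hF ha ⊢
    obtain ⟨b, hb⟩ : (2 : ℤ) ∣ F.b :=
      Int.prime_two.dvd_of_dvd_pow (n := 2) ⟨2 * (Δ + F.a * F.c), by linear_combination hF⟩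
    obtain ⟨j, hj⟩ : ∃ j, F.a = 2 * j + 1 := ⟨F.a / 2, by omega⟩
    -- the shift makes half the middle coefficient congruent to `Δ` modulo `2`
    refine ⟨b + Δ, ⟨F.a * (b + Δ) + b, by rw [hb]; ring⟩, ?_⟩
    set e := F.a * (b + Δ) + b with he
    obtain ⟨l, hl⟩ : ∃ l, e = Δ + 2 * l := ⟨b + j * (b + Δ), by rw [he, hj]; ring⟩
    have h1 : F.a * (F.a * (b + Δ) ^ 2 + F.b * (b + Δ) + F.c) = e ^ 2 - Δ := by
      rw [hb] at hF ⊢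
      linarith
    have h4 : (2 : ℤ) ^ 2 ∣ F.a * (F.a * (b + Δ) ^ 2 + F.b * (b + Δ) + F.c) := by
      rw [h1, hl]
      obtain ⟨m, hm⟩ : (4 : ℤ) ∣ Δ * (Δ - 1) := by
        rcases hΔ with h | h
        · exact (Int.dvd_of_emod_eq_zero h).mul_right _
        · exact (show (4 : ℤ) ∣ Δ - 1 by omega).mul_left _
      exact ⟨m + Δ * l + l ^ 2, by linear_combination hm⟩
    exact (((Int.prime_two.coprime_iff_not_dvd).2 ha).pow_left (m := 2)).dvd_of_dvd_mul_left h4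
  · have h2' : ¬ (p : ℤ) ∣ 2 := fun h => h2
      ((Nat.prime_dvd_prime_iff_eq hp Nat.prime_two).1 (by exact_mod_cast h))
    have h2a : IsCoprime (p : ℤ) (2 * F.a) := (hpp.coprime_iff_not_dvd).2 fun h =>
      (hpp.dvd_or_dvd h).elim h2' ha
    obtain ⟨u, v, huv⟩ := h2a
    obtain ⟨b, hb⟩ : (p : ℤ) ∣ 2 * F.a * (-F.b * v) + F.b :=
      ⟨F.b * u, by linear_combination (-F.b) * huv⟩
    refine ⟨-F.b * v, ⟨b, hb⟩, ?_⟩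
    have h4a : IsCoprime ((p : ℤ) ^ 2) (4 * F.a) := by
      refine IsCoprime.pow_left ((hpp.coprime_iff_not_dvd).2 fun h => ?_)
      rw [show (4 : ℤ) * F.a = 2 * (2 * F.a) by ring] at h
      exact (hpp.dvd_or_dvd h).elim h2' fun h => (hpp.dvd_or_dvd h).elim h2' ha
    refine h4a.dvd_of_dvd_mul_left ⟨b ^ 2 - Δ, ?_⟩
    linear_combination (2 * F.a * (-F.b * v) + F.b + p * b) * hb - hF

variable {Δ : ℤ} {p : ℕ} {f F : BinForm} {r : ℤ}

/-- The characters of a genus of discriminant `Δ p²` over the genus of `f` agree with those of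
`f`. -/
theorem character_eq_of_corresponds (hf : f.OfDisc Δ) (hf_alone : AloneInGenus Δ f)
    (hF : F.OfDisc (Δ * (p : ℤ) ^ 2)) (hF_alone : AloneInGenus (Δ * (p : ℤ) ^ 2) F)
    (hcorr : Corresponds Δ p (genus (Δ * (p : ℤ) ^ 2) F) (genus Δ f))
    (hr : IsCoprime r (Δ * (p : ℤ) ^ 2)) (hFr : F.Represents r)
    {χ : ℤ → ℤ} (hχ : IsAssignedCharacter Δ χ) {s : ℤ} (hs : IsCoprime s Δ)
    (hfs : f.Represents s) : χ r = χ s := by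
  obtain ⟨r₁, r₂, h1, h2, ⟨g, hg, hg1⟩, ⟨G, hG, hG2⟩, h⟩ := hcorr
  rw [assignedCharacter_eq hF.disc_eq hFr ((hF_alone G hG).represents hG2) hr.of_mul_right_left
    h2.of_mul_right_left hχ, ← h χ hχ]
  exact assignedCharacter_eq (m := 1) (by rw [hf.disc_eq]; ring)
    ((hf_alone g hg).represents hg1) hfs h1.of_mul_right_left hs hχ

variable [hp : Fact p.Prime]

/-- If `F` is in a genus that corresponds to that of `f` and `f` is alone in its genus, then `F` is
the restriction of `f` to a lattice of index `p`. -/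
theorem exists_subst_eq (hf : f.OfDisc Δ) (hf_alone : AloneInGenus Δ f)
    (hF : F.OfDisc (Δ * (p : ℤ) ^ 2)) (hr : IsCoprime r (Δ * (p : ℤ) ^ 2)) (hFr : F.Represents r)
    (hχ : ∀ χ, IsAssignedCharacter Δ χ → ∀ s, IsCoprime s Δ → f.Represents s → χ r = χ s) :
    ∃ M : Matrix (Fin 2) (Fin 2) ℤ, M.det = p ∧ f.subst M = F := by
  have hp0 : (p : ℤ) ≠ 0 := by exact_mod_cast hp.out.ne_zero
  have hpr : ¬ (p : ℤ) ∣ r :=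
    not_natCast_dvd_of_isCoprime hp.out hr ((dvd_pow_self _ two_ne_zero).mul_left _)
  obtain ⟨x, y, hxy⟩ := id hFr
  have hxy0 : ¬(x = 0 ∧ y = 0) := by
    rintro ⟨rfl, rfl⟩
    exact hpr (by rw [← hxy]; simp [eval])
  obtain ⟨M, d, hM, rfl, rfl⟩ := exists_det_eq_one_smul_col hxy0
  have hrd : r = (F.subst M).a * d ^ 2 := by
    rw [← hxy]; simp only [subst, eval]; ring
  have ha : ¬ (p : ℤ) ∣ (F.subst M).a := fun h => hpr (hrd ▸ h.mul_right _)
  have hdisc : (F.subst M).disc = Δ * (p : ℤ) ^ 2 := by rw [disc_subst, hM, hF.disc_eq]; ring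
  obtain ⟨k, ⟨b, hb⟩, ⟨c, hc⟩⟩ := exists_shift_dvd hp.out hf.disc_emod_four hdisc ha
  have hMk : (M * !![1, k; 0, 1]).det = 1 := by
    rw [Matrix.det_mul, hM, Matrix.det_fin_two_of]; norm_num
  obtain ⟨f₁, hf₁a, hf₁⟩ : ∃ f₁ : BinForm, f₁.a = (F.subst M).a ∧
      F.subst (M * !![1, k; 0, 1]) = f₁.subst !![1, 0; 0, (p : ℤ)] := by
    refine ⟨⟨(F.subst M).a, b, c⟩, rfl, ?_⟩
    rw [subst_mul, subst_diag]
    generalize F.subst M = G at *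
    ext
    · simp [subst, eval]
    · simp [subst]; linear_combination hb
    · simp [subst, eval]; linear_combination hc
  have hrep : f₁.Represents r := by
    apply Represents.of_subst (M := !![1, 0; 0, (p : ℤ)])
    rw [← hf₁, subst_mul]
    refine ⟨d, 0, ?_⟩
    rw [hrd, eval_subst]; simp [eval]
  have hf₁D : f₁.OfDisc Δ := by
    refine ⟨?_, hf.disc_neg, ?_, ?_⟩
    · have h1 := congrArg disc hf₁
      rw [disc_subst, hMk, hF.disc_eq, disc_subst, Matrix.det_fin_two_of] at h1
      apply mul_left_cancel₀ (pow_ne_zero 2 hp0)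
      linear_combination -h1
    · rw [hf₁a]
      apply hF.eval_pos
      rintro ⟨h1, h2⟩
      exact hxy0 ⟨by rw [h1, zero_mul], by rw [h2, zero_mul]⟩
    · apply isPrimitive_of_subst (M := !![1, 0; 0, (p : ℤ)])
      rw [← hf₁]
      exact hF.primitive.subst hMk
  have hgen : f₁ ∈ genus Δ f := by
    obtain ⟨s, hs, hsc⟩ := hf.primitive.exists_represents_isCoprime hf.disc_neg.ne
    exact ⟨hf₁D, s, r, hsc, hr.of_mul_right_left, hs, hrep, fun χ h => (hχ χ h s hsc hs).symm⟩
  obtain ⟨N, hN, rfl⟩ := equivalent_iff.1 (hf_alone _ hgen)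
  refine ⟨N * !![1, 0; 0, (p : ℤ)] * (M * !![1, k; 0, 1]).adjugate, ?_, ?_⟩
  · rw [Matrix.det_mul, Matrix.det_mul, Matrix.det_adjugate, hMk, hN, Matrix.det_fin_two_of]; simp
  · rw [subst_mul, subst_mul, ← hf₁, ← subst_mul, Matrix.mul_adjugate, hMk, one_smul, subst_one]

/-- A vector `v` at which the value of `f` is prime to `p`, with the residue of the genus of `F`,
lies in the image of an embedding of `F` into `f`: the restriction of `f` to the lattice
`ℤ v + p ℤ²` is in the genus of `F`. -/
theorem exists_subst_eq_of_eval (hf : f.OfDisc Δ)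
    (hF_alone : AloneInGenus (Δ * (p : ℤ) ^ 2) F)
    (hr : IsCoprime r (Δ * (p : ℤ) ^ 2)) (hFr : F.Represents r)
    (hχ : ∀ χ, IsAssignedCharacter Δ χ → ∀ s, IsCoprime s Δ → f.Represents s → χ r = χ s)
    {v : ℤ × ℤ} (hpv : ¬ (p : ℤ) ∣ f.eval v.1 v.2) (hrv : SameResidue Δ p r (f.eval v.1 v.2)) :
    ∃ M : Matrix (Fin 2) (Fin 2) ℤ, M.det = p ∧ f.subst M = F ∧ ∃ x, act M x = v := by
  have hp0 : (p : ℤ) ≠ 0 := by exact_mod_cast hp.out.ne_zero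
  have hpp : Prime (p : ℤ) := Nat.prime_iff_prime_int.1 hp.out
  obtain ⟨x, y⟩ := v
  dsimp only at hpv hrv
  have hxy0 : ¬(x = 0 ∧ y = 0) := by
    rintro ⟨rfl, rfl⟩
    exact hpv (by simp [eval])
  obtain ⟨M, d, hM, rfl, rfl⟩ := exists_det_eq_one_smul_col hxy0
  have hnd : f.eval (M 0 0 * d) (M 1 0 * d) = (f.subst M).a * d ^ 2 := by
    simp only [subst, eval]; ring
  have ha : ¬ (p : ℤ) ∣ (f.subst M).a := fun h => hpv (hnd ▸ h.mul_right _)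
  set D : Matrix (Fin 2) (Fin 2) ℤ := !![1, 0; 0, (p : ℤ)] with hDdef
  have hD : D.det = p := by rw [hDdef, Matrix.det_fin_two_of]; ring
  have hMD : f.subst (M * D) = ⟨(f.subst M).a, (f.subst M).b * p, (f.subst M).c * (p : ℤ) ^ 2⟩ := by
    rw [subst_mul, subst_diag]
  have hrep : (f.subst (M * D)).Represents (f.eval (M 0 0 * d) (M 1 0 * d)) :=
    ⟨d, 0, by rw [hMD, hnd]; simp [eval]⟩
  have hOD : (f.subst (M * D)).OfDisc (Δ * (p : ℤ) ^ 2) := by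
    refine ⟨?_, ?_, ?_, ?_⟩
    · rw [disc_subst, Matrix.det_mul, hM, hD, hf.disc_eq]; ring
    · have : 0 < (p : ℤ) ^ 2 := by positivity
      nlinarith [hf.disc_neg]
    · rw [hMD]
      apply hf.eval_pos
      rintro ⟨h1, h2⟩
      exact hxy0 ⟨by rw [h1, zero_mul], by rw [h2, zero_mul]⟩
    · rw [hMD]
      intro q h1 h2 h3
      dsimp only at h1 h2 h3
      have hqp : IsCoprime q (p : ℤ) :=
        (((hpp.coprime_iff_not_dvd).2 ha).symm).of_isCoprime_of_dvd_left h1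
      exact hf.primitive.subst hM q h1 (hqp.dvd_of_dvd_mul_right h2)
        ((hqp.pow_right).dvd_of_dvd_mul_right h3)
  have hgen := mem_genus_of_sameResidue hf.disc_emod_four hr hFr hOD hrep hpv hrv
    fun χ h s hs hrs => hχ χ h s hs hrs.of_subst
  obtain ⟨N, hN, hFN⟩ := equivalent_iff.1 (hF_alone _ hgen)
  refine ⟨M * D * N.adjugate, ?_, ?_, act N (d, 0), ?_⟩
  · rw [Matrix.det_mul, Matrix.det_mul, Matrix.det_adjugate, hM, hN, hD]; simp
  · rw [subst_mul, hFN, ← subst_mul, Matrix.mul_adjugate, hN, one_smul, subst_one]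
  · rw [act_mul, act_adjugate_act, hN, act_mul]
    simp [act, hDdef]

/-! ### Comparison of coefficients -/

theorem coeff_theta (f : BinForm) (n : ℕ) : PowerSeries.coeff n f.theta =
    (Nat.card {v : ℤ × ℤ // f.eval v.1 v.2 = (n : ℤ)} : ℚ) := PowerSeries.coeff_mk _ _

theorem coeff_theta_of_dvd (hF : F.IsPrimitive) {M : Matrix (Fin 2) (Fin 2) ℤ}
    (hM : M.det = p) (hMF : f.subst M = F) {n : ℕ} (hn : p ∣ n) :
    PowerSeries.coeff n F.theta = PowerSeries.coeff n (qpow (p ^ 2) f.theta) := by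
  have hpp : Prime (p : ℤ) := Nat.prime_iff_prime_int.1 hp.out
  rw [qpow, PowerSeries.coeff_mk, coeff_theta]
  split_ifs with h2
  · obtain ⟨m, rfl⟩ := h2
    rw [Nat.mul_div_cancel_left _ (pow_pos hp.out.pos 2), coeff_theta,
      ← card_eval_eq_sq_mul hF hpp hM hMF]
    push_cast; rfl
  · have : IsEmpty {v : ℤ × ℤ // F.eval v.1 v.2 = (n : ℤ)} := ⟨fun ⟨x, hx⟩ => h2 <| by
      have := sq_dvd_of_dvd_eval hF hpp hM hMF (x := x) (by rw [hx]; exact_mod_cast hn)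
      rw [hx] at this
      exact_mod_cast this⟩
    simp

theorem coeff_qpow_of_not_dvd (φ : PowerSeries ℚ) {m n : ℕ} (hn : ¬ m ∣ n) :
    PowerSeries.coeff n (qpow (m ^ 2) φ) = 0 := by
  rw [qpow, PowerSeries.coeff_mk, if_neg fun h => hn ((dvd_pow_self m two_ne_zero).trans h)]

theorem coeff_theta_of_not_sameResidue (hΔ : Δ % 4 = 0 ∨ Δ % 4 = 1)
    (hF : F.disc = Δ * (p : ℤ) ^ 2) (hpr : ¬ (p : ℤ) ∣ r)
    (hFr : F.Represents r) {n : ℕ} (hn : ¬ p ∣ n) (hrn : ¬ SameResidue Δ p r n) :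
    PowerSeries.coeff n F.theta = 0 := by
  have : IsEmpty {v : ℤ × ℤ // F.eval v.1 v.2 = (n : ℤ)} := ⟨fun ⟨x, hx⟩ => hrn <|
    Represents.sameResidue hF hΔ hFr ⟨_, _, hx⟩ hpr (by exact_mod_cast hn)⟩
  simp [coeff_theta]

open Classical in
/-- The common form of both identities on the level of coefficients: the terms of `θ_f` that
contribute have exponents prime to `p` with the residue of `r`. -/
theorem wNum_mul_coeff_theta (hf : f.OfDisc Δ) (hf_alone : AloneInGenus Δ f)
    (hF : F.OfDisc (Δ * (p : ℤ) ^ 2)) (hF_alone : AloneInGenus (Δ * (p : ℤ) ^ 2) F)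
    (hcorr : Corresponds Δ p (genus (Δ * (p : ℤ) ^ 2) F) (genus Δ f))
    (hr : IsCoprime r (Δ * (p : ℤ) ^ 2)) (hFr : F.Represents r) (n : ℕ) :
    wNum Δ * PowerSeries.coeff n F.theta = wNum Δ * PowerSeries.coeff n (qpow (p ^ 2) f.theta) +
      if ¬ p ∣ n ∧ SameResidue Δ p r n then PowerSeries.coeff n f.theta else 0 := by
  have hpp : Prime (p : ℤ) := Nat.prime_iff_prime_int.1 hp.out
  have hpr : ¬ (p : ℤ) ∣ r :=
    not_natCast_dvd_of_isCoprime hp.out hr ((dvd_pow_self _ two_ne_zero).mul_left _)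
  have hχ : ∀ χ, IsAssignedCharacter Δ χ → ∀ s, IsCoprime s Δ → f.Represents s → χ r = χ s :=
    fun χ h s hs hfs =>
      character_eq_of_corresponds hf hf_alone hF hF_alone hcorr hr hFr h hs hfs
  obtain ⟨M, hM, hMF⟩ := exists_subst_eq hf hf_alone hF hr hFr hχ
  by_cases hn : p ∣ n
  · rw [coeff_theta_of_dvd hF.primitive hM hMF hn, if_neg fun h => h.1 hn, add_zero]
  rw [coeff_qpow_of_not_dvd _ hn, mul_zero, zero_add]
  by_cases hrn : SameResidue Δ p r n
  · rw [if_pos ⟨hn, hrn⟩, coeff_theta, coeff_theta]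
    have hn' : ¬ (p : ℤ) ∣ (n : ℤ) := by exact_mod_cast hn
    refine wNum_mul_card_eval_eq hf hF hpp hM hMF hn' fun v hv => ?_
    exact exists_subst_eq_of_eval hf hF_alone hr hFr hχ (by rwa [hv]) (by rwa [hv])
  · rw [if_neg fun h => hrn h.2,
      coeff_theta_of_not_sameResidue hf.disc_emod_four hF.disc_eq hpr hFr hn hrn, mul_zero]

open Classical in
theorem coeff_proj (m : ℕ) (r : ℤ) (φ : PowerSeries ℚ) (n : ℕ) :
    PowerSeries.coeff n (proj m r φ) =
      if (n : ℤ) ≡ r [ZMOD (m : ℤ)] then PowerSeries.coeff n φ else 0 := by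
  rw [proj, PowerSeries.coeff_mk]

open Classical in
/-- At most one summand, `i = n % p`, contributes to the `n`-th coefficient of the sum, and its
weight is the indicator function of the condition that `r` and `n` have the same Legendre symbol. -/
theorem coeff_sum_legendreSym_proj (hp2 : p ≠ 2) (hpr : ¬ (p : ℤ) ∣ r) (φ : PowerSeries ℚ)
    (n : ℕ) :
    PowerSeries.coeff n (∑ i ∈ Finset.Icc 1 (p - 1),
      (((legendreSym p (r * (i : ℤ)) : ℚ) + 1) / 2) • proj p (i : ℤ) φ) =
      if ¬ p ∣ n ∧ SameResidue Δ p r n then PowerSeries.coeff n φ else 0 := by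
  rw [map_sum]
  simp only [map_smul, coeff_proj, smul_eq_mul]
  have hcong : ∀ i ∈ Finset.Icc 1 (p - 1), ((n : ℤ) ≡ i [ZMOD (p : ℤ)] ↔ n % p = i) := by
    intro i hi
    rw [Finset.mem_Icc] at hi
    rw [Int.natCast_modEq_iff, Nat.ModEq, Nat.mod_eq_of_lt (a := i) (by omega)]
  rw [Finset.sum_congr rfl fun i hi => by rw [if_congr (hcong i hi) rfl rfl]]
  simp only [mul_ite, mul_zero, Finset.sum_ite_eq, Finset.mem_Icc]
  have hlt := Nat.mod_lt n hp.out.pos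
  by_cases hn : p ∣ n
  · rw [if_neg (by rw [Nat.mod_eq_zero_of_dvd hn]; omega), if_neg fun h => h.1 hn]
  · have hn0 : n % p ≠ 0 := fun h => hn (Nat.dvd_of_mod_eq_zero h)
    rw [if_pos (by omega)]
    have hmod : legendreSym p ((n % p : ℕ) : ℤ) = legendreSym p n := by
      unfold legendreSym; simp
    have hr0 : (r : ZMod p) ≠ 0 := fun h0 => hpr ((ZMod.intCast_zmod_eq_zero_iff_dvd r p).1 h0)
    have hn0' : ((n : ℤ) : ZMod p) ≠ 0 := fun h0 =>
      hn (by exact_mod_cast (ZMod.intCast_zmod_eq_zero_iff_dvd n p).1 h0)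
    rw [legendreSym.mul, hmod]
    have hiff : SameResidue Δ p r n ↔ legendreSym p r = legendreSym p n :=
      ⟨fun h => h.1 hp2, fun h => ⟨fun _ => h, fun h2 => absurd h2 hp2⟩⟩
    simp only [hn, hiff, not_false_eq_true, true_and]
    rcases legendreSym.eq_one_or_neg_one p hr0 with h3 | h3 <;>
      rcases legendreSym.eq_one_or_neg_one p hn0' with h4 | h4 <;> rw [h3, h4] <;> norm_num

end BinForm

theorem theorem1p1 (p : ℕ) [Fact p.Prime] (Δ : ℤ) (f F : BinForm)
    (hf : f.OfDisc Δ) (hf_alone : AloneInGenus Δ f)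
    (hF : F.OfDisc (Δ * (p : ℤ) ^ 2)) (hF_alone : AloneInGenus (Δ * (p : ℤ) ^ 2) F)
    (hcorr : Corresponds Δ p (genus (Δ * (p : ℤ) ^ 2) F) (genus Δ f))
    (r : ℤ) (hr : IsCoprime r (Δ * (p : ℤ) ^ 2)) (hFr : F.Represents r) :
    (p ≠ 2 →
      wNum Δ • F.theta = wNum Δ • qpow (p ^ 2) f.theta +
        ∑ i ∈ Finset.Icc 1 (p - 1),
          (((legendreSym p (r * (i : ℤ)) : ℚ) + 1) / 2) • proj p (i : ℤ) f.theta) ∧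
    (p = 2 →
      wNum Δ • F.theta = wNum Δ • qpow 4 f.theta + proj (2 ^ (tNum Δ + 1)) r f.theta) := by
  have hp : p.Prime := Fact.out
  have hpr : ¬ (p : ℤ) ∣ r :=
    BinForm.not_natCast_dvd_of_isCoprime hp hr ((dvd_pow_self _ two_ne_zero).mul_left _)
  have key := BinForm.wNum_mul_coeff_theta hf hf_alone hF hF_alone hcorr hr hFr
  refine ⟨fun hp2 => ?_, ?_⟩
  · ext n
    rw [map_add, map_smul, map_smul, smul_eq_mul, smul_eq_mul, key,
      BinForm.coeff_sum_legendreSym_proj (Δ := Δ) hp2 hpr]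
  · rintro rfl
    ext n
    rw [map_add, map_smul, map_smul, smul_eq_mul, smul_eq_mul, key, BinForm.coeff_proj]
    congr 2
    -- a residue class modulo `2 ^ (t + 1)` determines the parity, and `r` is odd
    have h2 : (n : ℤ) ≡ r [ZMOD 2 ^ (tNum Δ + 1)] → ¬ 2 ∣ n := fun h hn => by
      have h1 : (n : ℤ) ≡ r [ZMOD 2] := h.of_dvd (dvd_pow_self 2 (Nat.succ_ne_zero _))
      rw [Int.ModEq] at h1
      push_cast at hpr
      omega
    push_cast
    exact propext ⟨fun h => (h.2.2 rfl).symm, fun h =>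
      ⟨h2 h, fun h' => absurd rfl h', fun _ => h.symm⟩⟩
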